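/- Let $M=\mathbb R^2$ with coordinates $(t,z)$ and $TM=\mathbb R^4$ with coordinates $(t,z,x,y)$; functions $A\in C^\infty(M)$ are also regarded as functions on $TM$. Put $\nabla=x\partial_t+y\partial_z$, $\zeta_1(A)=tA_t+zA_z-2A$, and $$V_0(A)=A_z\partial_t-A_t\partial_z+(A_{tz}x+A_{zz}y)\partial_x-(A_{tt}x+A_{tz}y)\partial_y,\qquad V_1(A)=A_z\partial_x-A_t\partial_y .$$ On $J^0=TM\times\mathbb R$, with coordinate $u$ on the last factor, consider the following Lie algebras of vector fields, where $A_0,A_1,A_2,A_3$ range over $C^\infty(M)$: * $\mathfrak g_1$, consisting of the sums $W_0(A_0)+W_1(A_1)+W_2(A_2)+W_3(A_3)$ with $W_0(A)=V_0(A)-\tfrac16\nabla^3(A)\,\partial_u$, $W_1(A)=V_1(A)-\tfrac12\nabla^2(A)\,\partial_u$, $W_2(A)=\nabla(A)\,\partial_u$, $W_3(A)=A\,\partial_u$; * $\mathfrak g_2$, consisting of the sums $V_0(A_0)+\bigl(V_1(A_1)+\nabla(A_1)\,\partial_u\bigr)+2A_2\,\partial_u$; * $\mathfrak g_3=\mathfrak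 g_3(c_3,c_4)$, for constants $(c_3,c_4)\in\mathbb R^2\setminus\{(0,0)\}$, consisting of the sums $\bigl(V_0(A_0)+c_3\,\zeta_1(A_0)\,\partial_u\bigr)+\bigl(V_1(A_1)+c_4A_1\,\partial_u\bigr)$. Let $\mathfrak G_i$ be the Lie pseudogroup on $J^0$ generated by the local flows of the vector fields in $\mathfrak g_i$, acting by prolongation on the space $J^2(TM,\mathbb R)$ of two-jets of functions $u(t,z,x,y)$. Then the only differential invariants of this action are: 1. for $\mathfrak G_1$: $\ I_1=u_{ty}-u_{xz}+u_{xx}u_{yy}-u_{xy}^2$; 2. for $\mathfrak G_2$: $\ I_2=(u_y-x)^2u_{xx}-2(u_x+y)(u_y-x)u_{xy}+(u_x+y)^2u_{yy}$ and $I_3=u_{xx}u_{yy}-u_{xy}^2$; 3. for $\mathfrak G_3$ (for every $(c_3,c_4)\ne(0,0)$): $\ I_3$ and $I_4=u_y^2u_{xx}-2u_xu_yu_{xy}+u_x^2u_{yy}$. Here "the only differential invariants" means: the listed functions are invariant under the prolonged action of the pseudogroup on all of $J^2(TM,\mathbb R)$, and there is a dense open set $\Omega\subset J^2(TM,\mathbb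 R)$ on which their differentials are linearly independent and such that, whenever $F$ is a smooth function on an open set $U\subset J^2(TM,\mathbb R)$ that is constant along the pieces in $U$ of the trajectories of the prolonged flows of the vector fields in $\mathfrak g_i$ (in particular, whenever $F$ is constant on the intersections of $U$ with the orbits of $\mathfrak G_i$), $F$ is, near every point of $U\cap\Omega$, a smooth function of the listed invariants. -/

import Mathlib

namespace Plebanski

open scoped ContDiff Topology

noncomputable section

/-! ### The spaces `M`, `TM`, `J⁰`, `J²` -/

/-- The surface `M = ℝ²` with canonical coordinates `(t, z)` and area form `dt ∧ dz`. -/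
abbrev M : Type := Fin 2 → ℝ

/-- The tangent bundle `TM = ℝ⁴`, with coordinates in the order `(t, z, x, y)`. -/
abbrev TM : Type := Fin 4 → ℝ

/-- The space of zero-jets `J⁰ = TM × ℝ`, with coordinates `(t, z, x, y)` and `u`. -/
abbrev J0 : Type := TM × ℝ

/-- The 19-dimensional space `J²(TM, ℝ)` of two-jets of functions on `TM`: a base point, the
value `u`, the first derivatives `u_i`, and the second derivatives `u_{ij}`, which are indexed by
unordered pairs of coordinates. -/
abbrev J2 : Type := TM × ℝ × (Fin 4 → ℝ) × (Sym2 (Fin 4) → ℝ)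

/-- Index of the coordinate `t`. -/
abbrev ct : Fin 4 := 0

/-- Index of the coordinate `z`. -/
abbrev cz : Fin 4 := 1

/-- Index of the coordinate `x`. -/
abbrev cx : Fin 4 := 2

/-- Index of the coordinate `y`. -/
abbrev cy : Fin 4 := 3

/-- The point of `J⁰` below a two-jet. -/
def J2.toJ0 (p : J2) : J0 := (p.1, p.2.1)

/-- The value at a two-jet of the base coordinate with index `i`. -/
def J2.base (p : J2) (i : Fin 4) : ℝ := p.1 i

/-- The jet coordinate `u_i`. -/
def J2.u1 (p : J2) (i : Fin 4) : ℝ := p.2.2.1 i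

/-- The jet coordinate `u_{ij}`. -/
def J2.u2 (p : J2) (i j : Fin 4) : ℝ := p.2.2.2 s(i, j)

/-- The partial derivative of `f` with respect to the coordinate with index `i`. -/
def pd {n : ℕ} (i : Fin n) (f : (Fin n → ℝ) → ℝ) : (Fin n → ℝ) → ℝ :=
  fun q => fderiv ℝ f q (Pi.single i 1)

/-- `p` is the two-jet of the function `σ` (smooth near the base point of `p`). -/
def IsJetOf (p : J2) (σ : TM → ℝ) : Prop :=
  ContDiffAt ℝ ∞ σ p.1 ∧ σ p.1 = p.2.1 ∧ (∀ i, pd i σ p.1 = p.u1 i) ∧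
    ∀ i j, pd j (pd i σ) p.1 = p.u2 i j

/-! ### The Lie algebras -/

/-- The pull-back of a function `A(t, z)` from `M` to `TM`. -/
def pull (A : M → ℝ) : TM → ℝ := fun q => A ![q ct, q cz]

/-- The operator `∇ = x ∂_t + y ∂_z`. -/
def nabla (f : TM → ℝ) : TM → ℝ := fun q => q cx * pd ct f q + q cy * pd cz f q

/-- The cocycle `ζ₁(A) = t A_t + z A_z - 2 A`. -/
def zeta (A : M → ℝ) : TM → ℝ := fun q =>
  q ct * pd ct (pull A) q + q cz * pd cz (pull A) q - 2 * pull A q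

/-- `V₀(A) = A_z ∂_t - A_t ∂_z + (A_{tz} x + A_{zz} y) ∂_x - (A_{tt} x + A_{tz} y) ∂_y`. -/
def V0 (A : M → ℝ) : TM → TM := fun q =>
  ![pd cz (pull A) q,
    -pd ct (pull A) q,
    pd cz (pd ct (pull A)) q * q cx + pd cz (pd cz (pull A)) q * q cy,
    -(pd ct (pd ct (pull A)) q * q cx + pd cz (pd ct (pull A)) q * q cy)]

/-- `V₁(A) = A_z ∂_x - A_t ∂_y`. -/
def V1 (A : M → ℝ) : TM → TM := fun q =>
  ![0, 0, pd cz (pull A) q, -pd ct (pull A) q]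

/-- The vector field `V + ψ ∂_u` on `J⁰`, for a vector field `V` and a function `ψ` on `TM`. -/
def addVertical (V : TM → TM) (ψ : TM → ℝ) : J0 → J0 := fun w => (V w.1, ψ w.1)

/-- `W₀(A) = V₀(A) - (1/6) ∇³(A) ∂_u`. -/
def W0 (A : M → ℝ) : J0 → J0 :=
  addVertical (V0 A) fun q => -(1 / 6 * nabla (nabla (nabla (pull A))) q)

/-- `W₁(A) = V₁(A) - (1/2) ∇²(A) ∂_u`. -/
def W1 (A : M → ℝ) : J0 → J0 :=
  addVertical (V1 A) fun q => -(1 / 2 * nabla (nabla (pull A)) q)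

/-- `W₂(A) = ∇(A) ∂_u`. -/
def W2 (A : M → ℝ) : J0 → J0 := addVertical 0 (nabla (pull A))

/-- `W₃(A) = A ∂_u`. -/
def W3 (A : M → ℝ) : J0 → J0 := addVertical 0 (pull A)

/-- The Lie algebra `𝔤₁` of the vector fields `W₀(A₀) + W₁(A₁) + W₂(A₂) + W₃(A₃)`, where the
`Aᵢ` are smooth functions on `M`. -/
def g1 : Set (J0 → J0) :=
  {X | ∃ A : Fin 4 → M → ℝ, (∀ i, ContDiff ℝ ∞ (A i)) ∧
    X = W0 (A 0) + W1 (A 1) + W2 (A 2) + W3 (A 3)}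

/-- `V̂₀(A) = V₀(A) + ((1/6) c₁ ∇³(A) + c₃ ζ₁(A)) ∂_u`. -/
def hatV0 (c₁ c₃ : ℝ) (A : M → ℝ) : J0 → J0 :=
  addVertical (V0 A) fun q => 1 / 6 * c₁ * nabla (nabla (nabla (pull A))) q + c₃ * zeta A q

/-- `V̂₁(A) = V₁(A) + ((1/2) c₁ ∇²(A) + c₂ ∇(A) + c₄ A) ∂_u`. -/
def hatV1 (c₁ c₂ c₄ : ℝ) (A : M → ℝ) : J0 → J0 :=
  addVertical (V1 A) fun q =>
    1 / 2 * c₁ * nabla (nabla (pull A)) q + c₂ * nabla (pull A) q + c₄ * pull A q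

/-- `V̂₂(A) = (c₁ ∇(A) + 2 c₂ A) ∂_u`. -/
def hatV2 (c₁ c₂ : ℝ) (A : M → ℝ) : J0 → J0 :=
  addVertical 0 fun q => c₁ * nabla (pull A) q + 2 * c₂ * pull A q

/-- `V̂₃(A) = c₁ A ∂_u`. -/
def hatV3 (c₁ : ℝ) (A : M → ℝ) : J0 → J0 := addVertical 0 fun q => c₁ * pull A q

/-- The Lie algebra `𝔥_{(c₁,c₂,c₃,c₄)}` of the vector fields
`V̂₀(A₀) + V̂₁(A₁) + V̂₂(A₂) + V̂₃(A₃)`, where the `Aᵢ` are smooth functions on `M`. -/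
def h (c₁ c₂ c₃ c₄ : ℝ) : Set (J0 → J0) :=
  {X | ∃ A : Fin 4 → M → ℝ, (∀ i, ContDiff ℝ ∞ (A i)) ∧
    X = hatV0 c₁ c₃ (A 0) + hatV1 c₁ c₂ c₄ (A 1) + hatV2 c₁ c₂ (A 2) + hatV3 c₁ (A 3)}

/-- The Lie algebra `𝔤₂ = 𝔥_{(0,1,0,0)}`. -/
def g2 : Set (J0 → J0) := h 0 1 0 0

/-- The Lie algebra `𝔤₃ = 𝔥_{(0,0,c₃,c₄)}`. -/
def g3 (c₃ c₄ : ℝ) : Set (J0 → J0) := h 0 0 c₃ c₄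

/-! ### The pseudogroups and their action on two-jets -/

/-- The local diffeomorphism `e` of `J⁰` is the time-`τ` map of the local flow `Φ` of the vector
field `X`, which is defined and smooth on an open set containing `[0, τ] × e.source`
(`[τ, 0] × e.source` if `τ < 0`). -/
def IsFlowMap (X : J0 → J0) (τ : ℝ) (e : OpenPartialHomeomorph J0 J0) : Prop :=
  ContDiffOn ℝ ∞ e.symm e.target ∧
  ∃ (O : Set (ℝ × J0)) (Φ : ℝ × J0 → J0),
    IsOpen O ∧ Set.uIcc 0 τ ×ˢ e.source ⊆ O ∧ ContDiffOn ℝ ∞ Φ O ∧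
    ∀ w ∈ e.source, Φ (0, w) = w ∧ Φ (τ, w) = e w ∧
      ∀ s ∈ Set.uIcc 0 τ, HasDerivAt (fun r => Φ (r, w)) (X (Φ (s, w))) s

/-- The Lie pseudogroup on `J⁰` with the Lie algebra `𝔤`: the smallest pseudogroup of local
homeomorphisms of `J⁰` that contains the local flows of all vector fields in `𝔤`. -/
def pseudogroup (𝔤 : Set (J0 → J0)) : StructureGroupoid J0 :=
  sInf {G | ∀ X ∈ 𝔤, ∀ τ : ℝ, ∀ e : OpenPartialHomeomorph J0 J0, IsFlowMap X τ e → e ∈ G}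

/-- The second prolongation of the local transformation `e` of `J⁰` maps the two-jet `p` to the
two-jet `p'`: near the point below `p`, it maps the graph of a function with two-jet `p` into the
graph of a function with two-jet `p'`. -/
def Prolongs (e : OpenPartialHomeomorph J0 J0) (p p' : J2) : Prop :=
  p.toJ0 ∈ e.source ∧ e p.toJ0 = p'.toJ0 ∧
  ∃ σ σ' : TM → ℝ, IsJetOf p σ ∧ IsJetOf p' σ' ∧
    ∀ᶠ a in 𝓝 p.1, (e (a, σ a)).2 = σ' (e (a, σ a)).1

/-! ### Differential invariants -/

/-- `F` is invariant under the prolonged action of the pseudogroup `G` on `J²`. -/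
def IsInvariant (G : StructureGroupoid J0) (F : J2 → ℝ) : Prop :=
  ∀ e ∈ G, ∀ p p' : J2, Prolongs e p p' → F p' = F p

/-- `F` is a local differential invariant on `U ⊆ J²`: it is constant along every piece of a
trajectory, lying in `U`, of a prolonged local flow of a vector field in `𝔤`. Every function on
`U` that is constant on the intersections of `U` with the orbits of the pseudogroup of `𝔤` has
this property. (Times in `[0, 1]` suffice, since the algebras considered are closed under
multiplication by scalars.) -/
def IsLocalInvariantOn (𝔤 : Set (J0 → J0)) (U : Set J2) (F : J2 → ℝ) : Prop :=
  ∀ X ∈ 𝔤, ∀ P : ℝ → J2,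
    (∀ s ∈ Set.Icc (0 : ℝ) 1, P s ∈ U ∧
      ∃ e : OpenPartialHomeomorph J0 J0, IsFlowMap X s e ∧ Prolongs e (P 0) (P s)) →
    F (P 1) = F (P 0)

/-- The functions `I 0, …, I (n - 1)` are the only second-order differential invariants of the
pseudogroup with the Lie algebra `𝔤`: they are smooth and invariant under the pseudogroup and, on
a dense open set of two-jets, they are functionally independent and every smooth local
differential invariant is locally a smooth function of them. -/
def OnlyInvariants (𝔤 : Set (J0 → J0)) {n : ℕ} (I : Fin n → J2 → ℝ) : Prop :=
  (∀ k, ContDiff ℝ ∞ (I k) ∧ IsInvariant (pseudogroup 𝔤) (I k)) ∧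
  ∃ Ω : Set J2, IsOpen Ω ∧ Dense Ω ∧
    (∀ p ∈ Ω, LinearIndependent ℝ fun k => fderiv ℝ (I k) p) ∧
    ∀ (U : Set J2) (F : J2 → ℝ), IsOpen U → ContDiffOn ℝ ∞ F U → IsLocalInvariantOn 𝔤 U F →
      ∀ p ∈ U ∩ Ω, ∃ f : (Fin n → ℝ) → ℝ, ContDiffAt ℝ ∞ f (fun k => I k p) ∧
        ∀ᶠ p' in 𝓝 p, F p' = f fun k => I k p'

/-- `I₁ = u_{ty} - u_{xz} + u_{xx} u_{yy} - u_{xy}²`. -/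
def I1 (p : J2) : ℝ :=
  p.u2 ct cy - p.u2 cx cz + p.u2 cx cx * p.u2 cy cy - p.u2 cx cy ^ 2

/-- `I₂ = (u_y - x)² u_{xx} - 2 (u_x + y) (u_y - x) u_{xy} + (u_x + y)² u_{yy}`. -/
def I2 (p : J2) : ℝ :=
  (p.u1 cy - p.base cx) ^ 2 * p.u2 cx cx
    - 2 * (p.u1 cx + p.base cy) * (p.u1 cy - p.base cx) * p.u2 cx cy
    + (p.u1 cx + p.base cy) ^ 2 * p.u2 cy cy

/-- `I₃ = u_{xx} u_{yy} - u_{xy}²`. -/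
def I3 (p : J2) : ℝ := p.u2 cx cx * p.u2 cy cy - p.u2 cx cy ^ 2

/-- `I₄ = u_y² u_{xx} - 2 u_x u_y u_{xy} + u_x² u_{yy}`. -/
def I4 (p : J2) : ℝ :=
  p.u1 cy ^ 2 * p.u2 cx cx - 2 * p.u1 cx * p.u1 cy * p.u2 cx cy + p.u1 cx ^ 2 * p.u2 cy cy

end

end Plebanski

namespace Plebanski

open scoped ContDiff Topology

noncomputable section

set_option linter.unusedSimpArgs false

/-! ### Directional derivatives -/

section Directional

variable {E F : Type*} [NormedAddCommGroup E] [NormedSpace ℝ E] [NormedAddCommGroup F]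
  [NormedSpace ℝ F]

/-- The derivative of `f` in the direction `v`. -/
def dd (v : E) (f : E → F) : E → F := fun x => fderiv ℝ f x v

theorem pd_eq_dd {n : ℕ} (i : Fin n) (f : (Fin n → ℝ) → ℝ) : pd i f = dd (Pi.single i 1) f := rfl

theorem _root_.Filter.EventuallyEq.dd {f g : E → F} {x : E} (h : f =ᶠ[𝓝 x] g) (v : E) :
    dd v f =ᶠ[𝓝 x] dd v g :=
  h.fderiv.mono fun y hy => by simp only [Plebanski.dd]; rw [hy]

theorem _root_.Filter.EventuallyEq.pd {n : ℕ} {f g : (Fin n → ℝ) → ℝ} {x : Fin n → ℝ}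
    (h : f =ᶠ[𝓝 x] g) (i : Fin n) : pd i f =ᶠ[𝓝 x] pd i g := h.dd _

theorem _root_.ContDiffAt.dd {f : E → F} {x : E} (h : ContDiffAt ℝ ∞ f x) (v : E) :
    ContDiffAt ℝ ∞ (dd v f) x :=
  (h.fderiv_right (m := ∞) (by simp)).clm_apply contDiffAt_const

theorem _root_.ContDiffAt.pd {n : ℕ} {f : (Fin n → ℝ) → ℝ} {x : Fin n → ℝ}
    (h : ContDiffAt ℝ ∞ f x) (i : Fin n) : ContDiffAt ℝ ∞ (pd i f) x := h.dd _

theorem _root_.ContDiffAt.eventually_differentiableAt {f : E → F} {x : E}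
    (h : ContDiffAt ℝ ∞ f x) : ∀ᶠ y in 𝓝 x, DifferentiableAt ℝ f y := by
  have h1 : ContDiffAt ℝ 1 f x := h.of_le (by exact_mod_cast le_top)
  exact (h1.eventually (by simp)).mono fun y hy => hy.differentiableAt (by simp)

theorem _root_.ContDiffAt.differentiableAt_of_infty {f : E → F} {x : E}
    (h : ContDiffAt ℝ ∞ f x) : DifferentiableAt ℝ f x := h.differentiableAt (by simp)

theorem dd_dd_apply {f : E → F} {x : E} (h : ContDiffAt ℝ ∞ f x) (v w : E) :
    dd v (dd w f) x = fderiv ℝ (fderiv ℝ f) x v w := by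
  have h1 : DifferentiableAt ℝ (fderiv ℝ f) x :=
    (h.fderiv_right (m := ∞) (by simp)).differentiableAt_of_infty
  have := h1.hasFDerivAt.clm_apply (hasFDerivAt_const w x)
  change fderiv ℝ (fun y => fderiv ℝ f y w) x v = _
  rw [this.fderiv]
  simp

theorem two_le_infty : (2 : WithTop ℕ∞) ≤ ∞ :=
  show ((2 : ℕ∞) : WithTop ℕ∞) ≤ ((⊤ : ℕ∞) : WithTop ℕ∞) from WithTop.coe_le_coe.2 le_top

theorem dd_comm {f : E → F} {x : E} (h : ContDiffAt ℝ ∞ f x) (v w : E) :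
    dd v (dd w f) x = dd w (dd v f) x := by
  rw [dd_dd_apply h, dd_dd_apply h]
  exact h.isSymmSndFDerivAt (by simpa using two_le_infty) v w

theorem pd_comm {n : ℕ} {f : (Fin n → ℝ) → ℝ} {x : Fin n → ℝ} (h : ContDiffAt ℝ ∞ f x)
    (i j : Fin n) : pd i (pd j f) x = pd j (pd i f) x := dd_comm h _ _

/-- The directional derivative of a slice of a function on `ℝ × E`. -/
theorem dd_slice {S : ℝ × E → F} {s : ℝ} {b : E} (h : DifferentiableAt ℝ S (s, b)) (v : E) :
    dd v (fun b => S (s, b)) b = dd ((0 : ℝ), v) S (s, b) := by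
  have h1 : HasFDerivAt (fun b : E => (s, b)) (ContinuousLinearMap.inr ℝ ℝ E) b :=
    hasFDerivAt_prodMk_right s b
  have := (h.hasFDerivAt.comp b h1).fderiv
  simp only [dd]
  erw [this]
  simp

theorem tendsto_slice {E : Type*} [TopologicalSpace E] (s : ℝ) (b : E) :
    Filter.Tendsto (fun b : E => (s, b)) (𝓝 b) (𝓝 (s, b)) :=
  (Continuous.prodMk_right s).tendsto b

section PartialDerivatives

variable {n : ℕ} {f g : (Fin n → ℝ) → ℝ} {x : Fin n → ℝ}

theorem pd_sub_apply (hf : DifferentiableAt ℝ f x) (hg : DifferentiableAt ℝ g x) (i : Fin n) :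
    pd i (fun q => f q - g q) x = pd i f x - pd i g x := by
  simp only [pd]
  rw [fderiv_fun_sub hf hg]
  rfl

theorem pd_mul_apply (hf : DifferentiableAt ℝ f x) (hg : DifferentiableAt ℝ g x) (i : Fin n) :
    pd i (fun q => f q * g q) x = f x * pd i g x + g x * pd i f x := by
  simp only [pd]
  rw [fderiv_fun_mul hf hg]
  rfl

theorem pd_sum_apply {ι : Type*} {u : Finset ι} {f : ι → (Fin n → ℝ) → ℝ}
    (hf : ∀ k ∈ u, DifferentiableAt ℝ (f k) x) (i : Fin n) :
    pd i (fun q => ∑ k ∈ u, f k q) x = ∑ k ∈ u, pd i (f k) x := by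
  simp only [pd]
  rw [fderiv_fun_sum hf]
  simp

end PartialDerivatives

theorem fderiv_eq_sum_pd {n : ℕ} (f : (Fin n → ℝ) → ℝ) (x v : Fin n → ℝ) :
    fderiv ℝ f x v = ∑ k, v k * pd k f x := by
  conv_lhs => rw [pi_eq_sum_univ' v, map_sum]
  exact Finset.sum_congr rfl fun k _ => by
    rw [map_smul, smul_eq_mul, pd]

/-- The derivative along `∂_s + V` on `ℝ × TM`. -/
def along (V : TM → TM) (f : ℝ × TM → ℝ) : ℝ × TM → ℝ :=
  fun x => fderiv ℝ f x ((1 : ℝ), V x.2)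

/-- If the derivative of `f` along `∂_s + V` is `g` on a time slice, then the derivative of
`∂_i f` along `∂_s + V` is `∂_i g - Σ_k ∂_i V^k ∂_k f` there. -/
theorem along_dd {V : TM → TM} {b₀ : TM} (hV : ContDiffAt ℝ ∞ V b₀) {f : ℝ × TM → ℝ} {s : ℝ}
    (hf : ContDiffAt ℝ ∞ f (s, b₀)) {g : TM → ℝ} (h : ∀ᶠ b in 𝓝 b₀, along V f (s, b) = g b)
    (i : Fin 4) :
    ∀ᶠ b in 𝓝 b₀, along V (dd ((0 : ℝ), Pi.single i 1) f) (s, b) =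
      pd i g b - ∑ k, pd i (fun q => V q k) b * dd ((0 : ℝ), Pi.single k 1) f (s, b) := by
  have h2 : ContDiffAt ℝ 2 f (s, b₀) := hf.of_le two_le_infty
  have e2 := (tendsto_slice s b₀).eventually (h2.eventually (by simp))
  filter_upwards [h.eventually_nhds, e2, hV.eventually_differentiableAt] with b hb hfb hVb
  set D := fderiv ℝ f with hD
  have hD1 : DifferentiableAt ℝ D (s, b) :=
    (hfb.fderiv_right (m := 1) (by norm_num)).differentiableAt (by simp)
  have hZ : HasFDerivAt (fun x : ℝ × TM => ((1 : ℝ), V x.2))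
      ((0 : ℝ × TM →L[ℝ] ℝ).prod (fderiv ℝ V b ∘L ContinuousLinearMap.snd ℝ ℝ TM)) (s, b) := by
    refine (hasFDerivAt_const (1 : ℝ) (s, b)).prodMk ?_
    exact (show HasFDerivAt V (fderiv ℝ V b) ((s, b) : ℝ × TM).2 from hVb.hasFDerivAt).comp (s, b)
      hasFDerivAt_snd
  have hL := hD1.hasFDerivAt.clm_apply hZ
  have hslice : pd i g b = dd ((0 : ℝ), Pi.single i 1) (along V f) (s, b) := by
    rw [← dd_slice (S := along V f) hL.differentiableAt]
    exact (Filter.EventuallyEq.dd hb _).symm.self_of_nhds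
  have hdd : fderiv ℝ (dd ((0 : ℝ), Pi.single i (1 : ℝ)) f) (s, b) =
      (fderiv ℝ D (s, b)).flip ((0 : ℝ), Pi.single i 1) := by
    have := (hD1.hasFDerivAt.clm_apply (hasFDerivAt_const ((0 : ℝ), Pi.single i (1 : ℝ)) (s, b)))
    simpa using! this.fderiv
  have hsym : fderiv ℝ D (s, b) (1, V b) ((0 : ℝ), Pi.single i 1) =
      fderiv ℝ D (s, b) ((0 : ℝ), Pi.single i 1) (1, V b) :=
    hfb.isSymmSndFDerivAt (by simp) _ _
  have hV0 : D (s, b) ((0 : ℝ), fderiv ℝ V b (Pi.single i 1)) =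
      ∑ k, pd i (fun q => V q k) b * dd ((0 : ℝ), Pi.single k 1) f (s, b) := by
    have h3 := fderiv_eq_sum_pd (fun b => f (s, b)) b (fderiv ℝ V b (Pi.single i 1))
    have hfd : DifferentiableAt ℝ f (s, b) := hfb.differentiableAt (by simp)
    have h4 := dd_slice hfd (fderiv ℝ V b (Pi.single i 1))
    simp only [dd] at h4
    rw [← hD] at h4
    rw [← h4, h3]
    refine Finset.sum_congr rfl fun k _ => ?_
    rw [pd_eq_dd k, dd_slice hfd]
    congr 1
    have := (hasFDerivAt_pi'.1 hVb.hasFDerivAt k).fderiv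
    simp only [pd]
    rw [this]
    rfl
  have hR : dd ((0 : ℝ), Pi.single i 1) (along V f) (s, b) =
      D (s, b) ((0 : ℝ), fderiv ℝ V b (Pi.single i 1)) +
      fderiv ℝ D (s, b) ((0 : ℝ), Pi.single i 1) (1, V b) := by
    have := congrArg (fun L => L ((0 : ℝ), Pi.single i (1 : ℝ))) hL.fderiv
    simp only [dd]
    erw [this]
    simp
  rw [hslice, hR, ← hV0, along, hdd]
  simp [hsym]

end Directional

/-! ### Jets and prolonged vector fields -/

/-- A symmetrised family of second order coordinates. -/
def symm2 (f : Fin 4 → Fin 4 → ℝ) : Sym2 (Fin 4) → ℝ :=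
  Sym2.lift ⟨fun i j => (f i j + f j i) / 2, fun i j => by ring⟩

theorem symm2_mk (f : Fin 4 → Fin 4 → ℝ) (i j : Fin 4) :
    symm2 f s(i, j) = (f i j + f j i) / 2 := rfl

/-- The two-jet of `σ` at `q`. -/
def jet (σ : TM → ℝ) (q : TM) : J2 :=
  (q, σ q, fun i => pd i σ q, symm2 fun i j => pd j (pd i σ) q)

theorem isJetOf_jet {σ : TM → ℝ} {q : TM} (h : ContDiffAt ℝ ∞ σ q) : IsJetOf (jet σ q) σ := by
  refine ⟨h, rfl, fun i => rfl, fun i j => ?_⟩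
  simp only [jet, J2.u2, symm2_mk]
  rw [pd_comm h i j]
  ring

theorem IsJetOf.eq_jet {p : J2} {σ : TM → ℝ} (h : IsJetOf p σ) : p = jet σ p.1 := by
  obtain ⟨hσ, h0, h1, h2⟩ := h
  refine Prod.ext rfl (Prod.ext h0.symm (Prod.ext (funext fun i => (h1 i).symm) ?_))
  funext z
  induction z with
  | _ i j =>
    simp only [jet, symm2_mk]
    rw [pd_comm hσ i j, h2 i j]
    simp only [J2.u2]
    ring

theorem jet_congr {σ σ' : TM → ℝ} {q : TM} (h : σ =ᶠ[𝓝 q] σ') : jet σ q = jet σ' q := by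
  simp only [jet]
  refine Prod.ext rfl (Prod.ext h.self_of_nhds (Prod.ext ?_ ?_))
  · exact funext fun i => (h.pd i).self_of_nhds
  · simp only
    congr 1
    funext i j
    exact ((h.pd i).pd j).self_of_nhds

/-- The second prolongation of the vector field `V + ψ ∂_u`. -/
def prol (V : TM → TM) (ψ : TM → ℝ) (p : J2) : J2 :=
  (V p.1, ψ p.1, fun i => pd i ψ p.1 - ∑ k, pd i (fun q => V q k) p.1 * p.u1 k,
    symm2 fun i j => pd j (pd i ψ) p.1 - ∑ k, (pd j (pd i fun q => V q k) p.1 * p.u1 k +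
      pd i (fun q => V q k) p.1 * p.u2 k j + pd j (fun q => V q k) p.1 * p.u2 k i))

/-- The jets of a family of functions whose graphs are moved by the flow of `V + ψ ∂_u` evolve
along the prolonged vector field. -/
theorem hasDerivAt_jet {V : TM → TM} (hV : ContDiff ℝ ∞ V) {ψ : TM → ℝ} (hψ : ContDiff ℝ ∞ ψ)
    {S : ℝ × TM → ℝ} {s : ℝ} {c : ℝ → TM} (hc : HasDerivAt c (V (c s)) s)
    (hS : ContDiffAt ℝ ∞ S (s, c s)) (h : ∀ᶠ b in 𝓝 (c s), along V S (s, b) = ψ b) :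
    HasDerivAt (fun r => jet (fun b => S (r, b)) (c r))
      (prol V ψ (jet (fun b => S (s, b)) (c s))) s := by
  have hVb : ContDiffAt ℝ ∞ V (c s) := hV.contDiffAt
  have hcurve : HasDerivAt (fun r => (r, c r)) ((1 : ℝ), V (c s)) s := (hasDerivAt_id s).prodMk hc
  have key : ∀ f : ℝ × TM → ℝ, ContDiffAt ℝ ∞ f (s, c s) →
      HasDerivAt (fun r => f (r, c r)) (along V f (s, c s)) s := fun f hf =>
    (show HasFDerivAt f (fderiv ℝ f (s, c s)) ((fun r => (r, c r)) s) from
      hf.differentiableAt_of_infty.hasFDerivAt).comp_hasDerivAt s hcurve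
  have tc : Filter.Tendsto (fun r => (r, c r)) (𝓝 s) (𝓝 (s, c s)) := hcurve.continuousAt
  have sl : ∀ f : ℝ × TM → ℝ, ContDiffAt ℝ ∞ f (s, c s) → ∀ i, ∀ᶠ x in 𝓝 (s, c s),
      pd i (fun b => f (x.1, b)) x.2 = dd ((0 : ℝ), Pi.single i 1) f x := fun f hf i =>
    hf.eventually_differentiableAt.mono fun x hx => dd_slice (s := x.1) (b := x.2) hx _
  have sl2 : ∀ f : ℝ × TM → ℝ, ContDiffAt ℝ ∞ f (s, c s) → ∀ i j, ∀ᶠ x in 𝓝 (s, c s),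
      pd j (pd i (fun b => f (x.1, b))) x.2 =
        dd ((0 : ℝ), Pi.single j 1) (dd ((0 : ℝ), Pi.single i 1) f) x := fun f hf i j => by
    filter_upwards [(sl f hf i).eventually_nhds, sl _ (hf.dd ((0 : ℝ), Pi.single i 1)) j]
      with x hx hx'
    rw [← hx']
    have : (fun b => pd i (fun b => f (x.1, b)) b) =ᶠ[𝓝 x.2]
        fun b => dd ((0 : ℝ), Pi.single i 1) f (x.1, b) :=
      (tendsto_slice x.1 x.2).eventually hx
    exact (this.pd j).self_of_nhds
  have a1 := fun i => along_dd hVb hS h i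
  have a2 := fun i j => (along_dd hVb (hS.dd ((0 : ℝ), Pi.single i 1)) (a1 i) j).self_of_nhds
  have e1 : ∀ i, dd ((0 : ℝ), Pi.single i 1) S (s, c s) =
      (jet (fun b => S (s, b)) (c s)).u1 i := fun i => ((sl S hS i).self_of_nhds).symm
  have hSs : ContDiffAt ℝ ∞ (fun b => S (s, b)) (c s) :=
    hS.comp (c s) (contDiffAt_const.prodMk contDiffAt_id)
  have e2 : ∀ i j, dd ((0 : ℝ), Pi.single j 1) (dd ((0 : ℝ), Pi.single i 1) S) (s, c s) =
      (jet (fun b => S (s, b)) (c s)).u2 i j := fun i j => by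
    rw [← (sl2 S hS i j).self_of_nhds, ← (isJetOf_jet hSs).2.2.2 i j]
    rfl
  have a2' : ∀ i j, along V (dd ((0 : ℝ), Pi.single j 1) (dd ((0 : ℝ), Pi.single i 1) S)) (s, c s) =
      pd j (pd i ψ) (c s) - ∑ k, (pd j (pd i fun q => V q k) (c s) *
        (jet (fun b => S (s, b)) (c s)).u1 k +
      pd i (fun q => V q k) (c s) * (jet (fun b => S (s, b)) (c s)).u2 k j +
      pd j (fun q => V q k) (c s) * (jet (fun b => S (s, b)) (c s)).u2 k i) := by
    intro i j
    have d1 : ∀ k, DifferentiableAt ℝ (pd i fun q => V q k) (c s) := fun k =>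
      ((contDiffAt_pi.1 hVb k).pd i).differentiableAt_of_infty
    have d2 : ∀ k, DifferentiableAt ℝ (fun b => dd ((0 : ℝ), Pi.single k 1) S (s, b)) (c s) :=
      fun k => ((hS.dd ((0 : ℝ), Pi.single k 1)).comp (c s)
        (contDiffAt_const.prodMk contDiffAt_id)).differentiableAt_of_infty
    have d3 : ∀ k, pd j (fun b => dd ((0 : ℝ), Pi.single k 1) S (s, b)) (c s) =
        (jet (fun b => S (s, b)) (c s)).u2 k j := fun k => by
      rw [← e2 k j]
      exact dd_slice (hS.dd ((0 : ℝ), Pi.single k 1)).differentiableAt_of_infty _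
    have d4 : ∀ k, dd ((0 : ℝ), Pi.single k 1) (dd ((0 : ℝ), Pi.single i 1) S) (s, c s) =
        (jet (fun b => S (s, b)) (c s)).u2 k i := fun k => by
      rw [dd_comm hS, e2]
    rw [a2 i j, pd_sub_apply (hψ.contDiffAt.pd i).differentiableAt_of_infty
      (DifferentiableAt.fun_sum fun k _ => (d1 k).fun_mul (d2 k)),
      pd_sum_apply fun k _ => (d1 k).fun_mul (d2 k), sub_sub, ← Finset.sum_add_distrib]
    congr 1
    refine Finset.sum_congr rfl fun k _ => ?_
    rw [pd_mul_apply (d1 k) (d2 k), d3, d4, e1]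
    ring
  refine hc.prodMk (HasDerivAt.prodMk ?_ (HasDerivAt.prodMk ?_ ?_))
  · have := key S hS
    rw [h.self_of_nhds] at this
    exact this
  · refine hasDerivAt_pi.2 fun i => ?_
    have := key _ (hS.dd ((0 : ℝ), Pi.single i 1))
    rw [(a1 i).self_of_nhds] at this
    simp only [e1] at this
    refine this.congr_of_eventuallyEq ?_
    exact tc.eventually (sl S hS i)
  · refine hasDerivAt_pi.2 fun z => ?_
    induction z with
    | _ i j =>
      simp only [symm2_mk]
      have k2 := fun i j => key _ ((hS.dd ((0 : ℝ), Pi.single i 1)).dd ((0 : ℝ), Pi.single j 1))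
      have := ((k2 i j).add (k2 j i)).div_const 2
      simp only [a2'] at this
      refine this.congr_of_eventuallyEq ?_
      filter_upwards [tc.eventually (sl2 S hS i j), tc.eventually (sl2 S hS j i)] with r h1 h2
      rw [h1, h2]
      rfl

/-! ### The groupoid of local transformations preserving a function of jets -/

/-- The local transformation `e` of `J⁰` maps graphs of smooth functions to graphs of smooth
functions, and the function `I` of their two-jets is preserved. -/
def Preserves (I : J2 → ℝ) (e : OpenPartialHomeomorph J0 J0) : Prop :=
  ∀ (q : TM) (σ : TM → ℝ), ContDiffAt ℝ ∞ σ q → (q, σ q) ∈ e.source →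
    ∃ σ' : TM → ℝ, ContDiffAt ℝ ∞ σ' (e (q, σ q)).1 ∧
      (∀ᶠ a in 𝓝 q, (e (a, σ a)).2 = σ' (e (a, σ a)).1) ∧
      Filter.map (fun a => (e (a, σ a)).1) (𝓝 q) = 𝓝 (e (q, σ q)).1 ∧
      I (jet σ' (e (q, σ q)).1) = I (jet σ q)

theorem tendsto_graph {σ : TM → ℝ} {q : TM} (hσ : ContDiffAt ℝ ∞ σ q) :
    Filter.Tendsto (fun a => (a, σ a)) (𝓝 q) (𝓝 (q, σ q)) :=
  continuousAt_id.prodMk hσ.continuousAt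

/-- `Preserves` is a local property. -/
theorem preserves_of_local {I : J2 → ℝ} {e : OpenPartialHomeomorph J0 J0}
    (h : ∀ w ∈ e.source, ∃ e', Preserves I e' ∧ w ∈ e'.source ∧ ∀ᶠ w' in 𝓝 w, e w' = e' w') :
    Preserves I e := by
  intro q σ hσ hq
  obtain ⟨e', he', hw, hee⟩ := h _ hq
  obtain ⟨σ', h1, h2, h3, h4⟩ := he' q σ hσ hw
  have hev := (tendsto_graph hσ).eventually hee
  have h0 : e (q, σ q) = e' (q, σ q) := hee.self_of_nhds
  rw [← h0] at h1 h3 h4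
  refine ⟨σ', h1, ?_, ?_, h4⟩
  · filter_upwards [hev, h2] with a ha ha2
    rw [ha, ha2]
  · rw [← h3]
    refine Filter.map_congr (hev.mono fun a ha => ?_)
    simp only [ha]

theorem Preserves.trans {I : J2 → ℝ} {e e' : OpenPartialHomeomorph J0 J0} (h : Preserves I e)
    (h' : Preserves I e') : Preserves I (e.trans e') := by
  intro q σ hσ hq
  rw [OpenPartialHomeomorph.trans_source] at hq
  obtain ⟨σ₁, h1, h2, h3, h4⟩ := h q σ hσ hq.1
  have h20 : e (q, σ q) = ((e (q, σ q)).1, σ₁ (e (q, σ q)).1) := Prod.ext rfl h2.self_of_nhds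
  have hq2 : e (q, σ q) ∈ e'.source := hq.2
  rw [h20] at hq2
  obtain ⟨σ₂, k1, k2, k3, k4⟩ := h' _ σ₁ h1 hq2
  rw [← h20] at k1 k3 k4
  have hmap : Filter.Tendsto (fun a => (e (a, σ a)).1) (𝓝 q) (𝓝 (e (q, σ q)).1) := h3.le
  refine ⟨σ₂, k1, ?_, ?_, k4.trans h4⟩
  · filter_upwards [h2, hmap.eventually k2] with a ha ha2
    have : e (a, σ a) = ((e (a, σ a)).1, σ₁ (e (a, σ a)).1) := Prod.ext rfl ha
    rw [← this] at ha2
    exact ha2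
  · change _ = 𝓝 (e' (e (q, σ q))).1
    rw [← k3, ← h3, Filter.map_map]
    refine Filter.map_congr (h2.mono fun a ha => ?_)
    have : e (a, σ a) = ((e (a, σ a)).1, σ₁ (e (a, σ a)).1) := Prod.ext rfl ha
    simp only [Function.comp_apply]
    rw [← this]
    rfl

theorem preserves_refl (I : J2 → ℝ) : Preserves I (OpenPartialHomeomorph.refl J0) := by
  intro q σ hσ _
  exact ⟨σ, hσ, Filter.Eventually.of_forall fun a => rfl, Filter.map_id, rfl⟩

/-- The groupoid of local transformations of `J⁰` that preserve the function `I` of two-jets. -/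
def preservingGroupoid (I : J2 → ℝ) : StructureGroupoid J0 where
  members := {e | Preserves I e ∧ Preserves I e.symm}
  trans' e e' h h' := ⟨h.1.trans h'.1, by
    rw [OpenPartialHomeomorph.trans_symm_eq_symm_trans_symm]
    exact h'.2.trans h.2⟩
  symm' e h := ⟨h.2, by rw [OpenPartialHomeomorph.symm_symm]; exact h.1⟩
  id_mem' := ⟨preserves_refl I, preserves_refl I⟩
  locality' e h := by
    refine ⟨preserves_of_local fun w hw => ?_, preserves_of_local fun w hw => ?_⟩
    · obtain ⟨s, hs, hws, hr⟩ := h w hw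
      exact ⟨e.restr s, hr.1, by simp [hs.interior_eq, hw, hws],
        Filter.Eventually.of_forall fun w' => rfl⟩
    · have hw' : w ∈ e.target := hw
      obtain ⟨s, hs, hws, hr⟩ := h _ (e.map_target hw')
      refine ⟨(e.restr s).symm, hr.2, ?_, Filter.Eventually.of_forall fun w' => rfl⟩
      simp [hs.interior_eq, hw', hws]
  mem_of_eqOnSource' e e' h hee := by
    refine ⟨preserves_of_local fun w hw => ⟨e, h.1, ?_, ?_⟩,
      preserves_of_local fun w hw => ⟨e.symm, h.2, ?_, ?_⟩⟩
    · rw [← hee.1]; exact hw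
    · exact Filter.eventually_of_mem (e'.open_source.mem_nhds hw) fun a ha => hee.2 ha
    · rw [← hee.symm'.1]; exact hw
    · exact Filter.eventually_of_mem (e'.symm.open_source.mem_nhds hw) fun a ha => hee.symm'.2 ha

theorem isInvariant_preservingGroupoid (I : J2 → ℝ) : IsInvariant (preservingGroupoid I) I := by
  rintro e ⟨he, -⟩ p p' ⟨hp, hpp', σ, σ', hσ, hσ', hev⟩
  have h0 : p.toJ0 = (p.1, σ p.1) := Prod.ext rfl hσ.2.1.symm
  rw [h0] at hp hpp'
  obtain ⟨σ₁, h1, h2, h3, h4⟩ := he _ σ hσ.1 hp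
  have hb : (e (p.1, σ p.1)).1 = p'.1 := by rw [hpp']; rfl
  rw [hb] at h1 h3 h4
  have : σ₁ =ᶠ[𝓝 p'.1] σ' := by
    rw [← h3, Filter.EventuallyEq, Filter.eventually_map]
    filter_upwards [h2, hev] with a ha ha'
    rw [← ha, ← ha']
  rw [hσ.eq_jet, hσ'.eq_jet, ← jet_congr this]
  exact h4

theorem IsInvariant.mono {G G' : StructureGroupoid J0} (h : G ≤ G') {I : J2 → ℝ}
    (hI : IsInvariant G' I) : IsInvariant G I := fun e he => hI e (h he)

/-! ### Flow maps -/

theorem IsFlowMap.contDiffOn {X : J0 → J0} {τ : ℝ} {e : OpenPartialHomeomorph J0 J0}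
    (h : IsFlowMap X τ e) : ContDiffOn ℝ ∞ e e.source := by
  obtain ⟨-, O, Φ, hO, hsub, hΦ, hfl⟩ := h
  have : ContDiffOn ℝ ∞ (fun w => Φ (τ, w)) e.source :=
    hΦ.comp (contDiff_prodMk_right τ).contDiffOn fun w hw => hsub ⟨Set.right_mem_uIcc, hw⟩
  exact this.congr fun w hw => ((hfl w hw).2.1).symm

theorem IsFlowMap.symm {X : J0 → J0} {τ : ℝ} {e : OpenPartialHomeomorph J0 J0}
    (h : IsFlowMap X τ e) : IsFlowMap (-X) τ e.symm := by
  have hsm := h.contDiffOn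
  obtain ⟨hs, O, Φ, hO, hsub, hΦ, hfl⟩ := h
  have hmem : ∀ s ∈ Set.uIcc 0 τ, τ - s ∈ Set.uIcc 0 τ := fun s hs => by
    rw [Set.mem_uIcc] at hs ⊢
    rcases hs with hs | hs
    · exact Or.inl ⟨by linarith, by linarith⟩
    · exact Or.inr ⟨by linarith, by linarith⟩
  let j : ℝ × J0 → ℝ × J0 := fun z => (τ - z.1, e.symm z.2)
  have hj : ContDiffOn ℝ ∞ j (Set.univ ×ˢ e.target) := by
    refine ContDiffOn.prodMk (contDiff_const.sub contDiff_fst).contDiffOn ?_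
    exact hs.comp contDiff_snd.contDiffOn fun z hz => hz.2
  refine ⟨by simpa using hsm, (Set.univ ×ˢ e.target) ∩ j ⁻¹' O, Φ ∘ j, ?_, ?_, ?_, ?_⟩
  · exact hj.continuousOn.isOpen_inter_preimage (isOpen_univ.prod e.open_target) hO
  · rintro ⟨s, w⟩ ⟨hs, hw⟩
    exact ⟨⟨trivial, hw⟩, hsub ⟨hmem s hs, e.map_target hw⟩⟩
  · exact hΦ.comp (hj.mono Set.inter_subset_left) fun z hz => hz.2
  · intro w hw
    have hw' : e.symm w ∈ e.source := e.map_target hw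
    obtain ⟨f0, f1, f2⟩ := hfl _ hw'
    refine ⟨?_, ?_, fun s hs => ?_⟩
    · simp only [j, Function.comp_apply, sub_zero, f1]
      exact e.right_inv hw
    · simp only [j, Function.comp_apply, sub_self, f0]
    · have := (f2 _ (hmem s hs)).scomp s ((hasDerivAt_id s).const_sub τ)
      simpa [j, Function.comp_def] using! this

theorem IsFlowMap.rescale {X : J0 → J0} {τ : ℝ} {e : OpenPartialHomeomorph J0 J0}
    (h : IsFlowMap X τ e) : IsFlowMap (τ • X) 1 e := by
  obtain ⟨hs, O, Φ, hO, hsub, hΦ, hfl⟩ := h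
  have hmem : ∀ s ∈ Set.uIcc (0 : ℝ) 1, τ * s ∈ Set.uIcc 0 τ := fun s hs => by
    rw [Set.uIcc_of_le zero_le_one] at hs
    rw [Set.mem_uIcc]
    rcases le_total 0 τ with h | h
    · exact Or.inl ⟨mul_nonneg h hs.1, mul_le_of_le_one_right h hs.2⟩
    · exact Or.inr ⟨by nlinarith [hs.1, hs.2], by nlinarith [hs.1, hs.2]⟩
  let j : ℝ × J0 → ℝ × J0 := fun z => (τ * z.1, z.2)
  have hj : ContDiff ℝ ∞ j := (contDiff_const.mul contDiff_fst).prodMk contDiff_snd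
  refine ⟨hs, j ⁻¹' O, Φ ∘ j, hO.preimage hj.continuous, ?_, ?_, fun w hw => ?_⟩
  · rintro ⟨s, w⟩ ⟨hs, hw⟩
    exact hsub ⟨hmem s hs, hw⟩
  · exact hΦ.comp hj.contDiffOn fun z hz => hz
  · obtain ⟨f0, f1, f2⟩ := hfl _ hw
    refine ⟨by simp [j, f0], by simp [j, f1], fun s hs => ?_⟩
    have := (f2 _ (hmem s hs)).scomp s ((hasDerivAt_id s).const_mul τ)
    simpa [j, Function.comp_def] using! this

/-! ### Graphs moved by a flow -/

section MovingGraph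

variable {V : TM → TM} {ψ : TM → ℝ} {O : Set (ℝ × J0)} {Φ : ℝ × J0 → J0} {D : Set J0}
  {q : TM} {σ : TM → ℝ}

/-- The trajectory of the point of the graph of `σ` above a given point. -/
def moved (Φ : ℝ × J0 → J0) (σ : TM → ℝ) : ℝ × TM → J0 := fun z => Φ (z.1, (z.2, σ z.2))

theorem contDiffAt_moved (hO : IsOpen O) (hΦ : ContDiffOn ℝ ∞ Φ O)
    (hσ : ContDiffAt ℝ ∞ σ q) {s : ℝ} (hs : (s, (q, σ q)) ∈ O) :
    ContDiffAt ℝ ∞ (moved Φ σ) (s, q) := by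
  have h1 : ContDiffAt ℝ ∞ Φ (s, (q, σ q)) := hΦ.contDiffAt (hO.mem_nhds hs)
  have h2 : ContDiffAt ℝ ∞ (fun z : ℝ × TM => (z.1, (z.2, σ z.2))) (s, q) :=
    contDiffAt_fst.prodMk (contDiffAt_snd.prodMk
      ((show ContDiffAt ℝ ∞ σ ((s, q) : ℝ × TM).2 from hσ).comp (s, q) contDiffAt_snd))
  exact ContDiffAt.comp (s, q) h1 h2

/-- The variational equation of the base flow. -/
theorem hasDerivAt_variation {φ : ℝ × TM → TM} (hV : ContDiff ℝ ∞ V) {s : ℝ}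
    (hφ : ContDiffAt ℝ ∞ φ (s, q))
    (h : ∀ᶠ a in 𝓝 q, HasDerivAt (fun r => φ (r, a)) (V (φ (s, a))) s) (v : TM) :
    HasDerivAt (fun r => dd ((0 : ℝ), v) φ (r, q))
      (fderiv ℝ V (φ (s, q)) (dd ((0 : ℝ), v) φ (s, q))) s := by
  have hr : HasDerivAt (fun r : ℝ => (r, q)) ((1 : ℝ), (0 : TM)) s :=
    (hasDerivAt_id s).prodMk (hasDerivAt_const s q)
  have h1 := (show HasFDerivAt (dd ((0 : ℝ), v) φ) (fderiv ℝ (dd ((0 : ℝ), v) φ) (s, q))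
    ((fun r : ℝ => (r, q)) s) from
      (hφ.dd ((0 : ℝ), v)).differentiableAt_of_infty.hasFDerivAt).comp_hasDerivAt s hr
  convert! h1 using 1
  have h2 : fderiv ℝ (dd ((0 : ℝ), v) φ) (s, q) ((1 : ℝ), (0 : TM)) =
      dd ((1 : ℝ), (0 : TM)) (dd ((0 : ℝ), v) φ) (s, q) := rfl
  rw [h2, dd_comm hφ,
    ← dd_slice (hφ.dd ((1 : ℝ), (0 : TM))).differentiableAt_of_infty]
  have h3 : (fun a => dd ((1 : ℝ), (0 : TM)) φ (s, a)) =ᶠ[𝓝 q] fun a => V (φ (s, a)) := by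
    filter_upwards [h, (tendsto_slice s q).eventually hφ.eventually_differentiableAt] with a ha hd
    have hr : HasDerivAt (fun r : ℝ => (r, a)) ((1 : ℝ), (0 : TM)) s :=
      (hasDerivAt_id s).prodMk (hasDerivAt_const s a)
    exact ((show HasFDerivAt φ (fderiv ℝ φ (s, a)) ((fun r : ℝ => (r, a)) s) from
      hd.hasFDerivAt).comp_hasDerivAt s hr).unique ha
  rw [(h3.dd v).self_of_nhds, ← dd_slice hφ.differentiableAt_of_infty]
  have h4 : DifferentiableAt ℝ (fun a => φ (s, a)) q :=
    hφ.differentiableAt_of_infty.comp q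
      ((differentiableAt_const s).prodMk differentiableAt_id)
  have h5 : HasFDerivAt V (fderiv ℝ V (φ (s, q))) ((fun a => φ (s, a)) q) :=
    (hV.differentiable (by simp)).differentiableAt.hasFDerivAt
  have h6 := (h5.comp q h4.hasFDerivAt).fderiv
  have := congrArg (fun L => L v) h6
  exact this.symm

/-- The base flow is an immersion at all times. -/
theorem variation_injective {φ : ℝ × TM → TM} (hV : ContDiff ℝ ∞ V)
    (hφ : ∀ s ∈ Set.Icc (0 : ℝ) 1, ContDiffAt ℝ ∞ φ (s, q))
    (h : ∀ᶠ a in 𝓝 q, ∀ s ∈ Set.Icc (0 : ℝ) 1, HasDerivAt (fun r => φ (r, a)) (V (φ (s, a))) s)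
    (h0 : ∀ᶠ a in 𝓝 q, φ (0, a) = a) {s : ℝ} (hs : s ∈ Set.Icc (0 : ℝ) 1) {v : TM}
    (hv : dd ((0 : ℝ), v) φ (s, q) = 0) : v = 0 := by
  have hder : ∀ r ∈ Set.Icc (0 : ℝ) 1, HasDerivAt (fun r => dd ((0 : ℝ), v) φ (r, q))
      (fderiv ℝ V (φ (r, q)) (dd ((0 : ℝ), v) φ (r, q))) r := fun r hr =>
    hasDerivAt_variation hV (hφ r hr) (h.mono fun a ha => ha r hr) v
  have hcont : ContinuousOn (fun r => ‖fderiv ℝ V (φ (r, q))‖) (Set.Icc 0 1) := by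
    intro r hr
    have hc : ContinuousAt (fun r => φ (r, q)) r :=
      (h.self_of_nhds r hr).continuousAt
    have hV' : Continuous (fderiv ℝ V) := hV.continuous_fderiv (by simp)
    exact ((hV'.continuousAt.comp hc).norm).continuousWithinAt
  obtain ⟨K, hK⟩ := isCompact_Icc.bddAbove_image hcont
  have hlip : ∀ r ∈ Set.Ioc (0 : ℝ) s,
      LipschitzOnWith K.toNNReal (fun x => fderiv ℝ V (φ (r, q)) x) Set.univ := fun r hr => by
    refine ((fderiv ℝ V (φ (r, q))).lipschitz.weaken ?_).lipschitzOnWith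
    rw [← NNReal.coe_le_coe]
    refine le_trans ?_ (Real.le_coe_toNNReal K)
    exact hK ⟨r, ⟨hr.1.le, hr.2.trans hs.2⟩, rfl⟩
  have huniq := ODE_solution_unique_of_mem_Icc_left (a := 0) (b := s)
    (v := fun r x => fderiv ℝ V (φ (r, q)) x) (s := fun _ => Set.univ)
    (f := fun r => dd ((0 : ℝ), v) φ (r, q)) (g := fun _ => 0) hlip
    (fun r hr => (hder r ⟨hr.1, hr.2.trans hs.2⟩).continuousAt.continuousWithinAt)
    (fun r hr => (hder r ⟨hr.1.le, hr.2.trans hs.2⟩).hasDerivWithinAt)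
    (fun _ _ => trivial) continuousOn_const
    (fun r _ => by simpa using hasDerivWithinAt_const r (Set.Iic r) (0 : TM))
    (fun _ _ => trivial) hv
  have h00 : dd ((0 : ℝ), v) φ (0, q) = 0 := huniq ⟨le_rfl, hs.1⟩
  have hz : (0 : ℝ) ∈ Set.Icc (0 : ℝ) 1 := ⟨le_rfl, zero_le_one⟩
  rw [← dd_slice (hφ 0 hz).differentiableAt_of_infty,
    (Filter.EventuallyEq.dd (g := id) h0 v).self_of_nhds] at h00
  simpa [dd] using h00

/-- Locally near a time `s`, the graphs of `σ` moved by a flow whose base part is immersive are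
the graphs of a smooth family of functions. -/
theorem exists_moving_family {φ : ℝ × TM → TM} {H : ℝ × TM → ℝ} {s : ℝ}
    (hφ : ContDiffAt ℝ ∞ φ (s, q)) (hH : ContDiffAt ℝ ∞ H (s, q))
    (hinj : ∀ v, dd ((0 : ℝ), v) φ (s, q) = 0 → v = 0) :
    ∃ S : ℝ × TM → ℝ, ContDiffAt ℝ ∞ S (s, φ (s, q)) ∧ ∀ᶠ z in 𝓝 (s, q), S (z.1, φ z) = H z := by
  have hΨ : ContDiffAt ℝ ∞ (fun z : ℝ × TM => (z.1, φ z)) (s, q) := contDiffAt_fst.prodMk hφ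
  let L : ℝ × TM →L[ℝ] ℝ × TM := (ContinuousLinearMap.fst ℝ ℝ TM).prod (fderiv ℝ φ (s, q))
  have hL : HasFDerivAt (fun z : ℝ × TM => (z.1, φ z)) L (s, q) :=
    hasFDerivAt_fst.prodMk hφ.differentiableAt_of_infty.hasFDerivAt
  have hLinj : Function.Injective (L : ℝ × TM →ₗ[ℝ] ℝ × TM) := by
    rw [injective_iff_map_eq_zero]
    rintro ⟨r, v⟩ hrv
    have h1 : r = 0 := congrArg Prod.fst hrv
    have h2 : fderiv ℝ φ (s, q) (r, v) = 0 := congrArg Prod.snd hrv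
    subst h1
    rw [hinj v h2]
    rfl
  let Le : (ℝ × TM) ≃L[ℝ] (ℝ × TM) := (LinearEquiv.ofInjectiveEndo _ hLinj).toContinuousLinearEquiv
  have hLe : (Le : ℝ × TM →L[ℝ] ℝ × TM) = L := by
    ext1 <;> rfl
  have hLe' : HasFDerivAt (fun z : ℝ × TM => (z.1, φ z)) (Le : ℝ × TM →L[ℝ] ℝ × TM) (s, q) := by
    rw [hLe]; exact hL
  have hst := hΨ.hasStrictFDerivAt' hLe' (by simp)
  refine ⟨H ∘ hst.localInverse _ Le _, ?_, ?_⟩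
  · have h1 := hΨ.to_localInverse hLe' (by simp)
    refine ContDiffAt.comp (s, φ (s, q)) ?_ h1
    have h2 := hst.localInverse_apply_image
    simp only at h2
    erw [h2]
    exact hH
  · filter_upwards [hst.eventually_left_inverse] with z hz
    simp only [Function.comp_apply]
    rw [hz]

theorem map_nhds_of_immersive {φ : ℝ × TM → TM} {s : ℝ} (hφ : ContDiffAt ℝ ∞ φ (s, q))
    (hinj : ∀ v, dd ((0 : ℝ), v) φ (s, q) = 0 → v = 0) :
    Filter.map (fun a => φ (s, a)) (𝓝 q) = 𝓝 (φ (s, q)) := by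
  have h1 : ContDiffAt ℝ ∞ (fun a => φ (s, a)) q :=
    hφ.comp q (contDiffAt_const.prodMk contDiffAt_id)
  refine (h1.hasStrictFDerivAt (by simp)).map_nhds_eq_of_surj ?_
  refine LinearMap.range_eq_top.2 (LinearMap.injective_iff_surjective.1 ?_)
  rw [injective_iff_map_eq_zero]
  intro v hv
  refine hinj v ?_
  rw [← dd_slice hφ.differentiableAt_of_infty]
  exact hv

end MovingGraph

/-- The flow of `V + ψ ∂_u` preserves every function of jets that is annihilated by the prolonged
vector field. -/
theorem preserves_of_isFlowMap {I : J2 → ℝ} (hI : Differentiable ℝ I) {V : TM → TM} {ψ : TM → ℝ}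
    (hV : ContDiff ℝ ∞ V) (hψ : ContDiff ℝ ∞ ψ)
    (hinv : ∀ p, fderiv ℝ I p (prol V ψ p) = 0) {e : OpenPartialHomeomorph J0 J0}
    (h : IsFlowMap (addVertical V ψ) 1 e) : Preserves I e := by
  obtain ⟨-, O, Φ, hO, hsub, hΦ, hfl⟩ := h
  rw [Set.uIcc_of_le zero_le_one] at hsub hfl
  intro q σ hσ hq
  set φ : ℝ × TM → TM := fun z => (moved Φ σ z).1 with hφdef
  set H : ℝ × TM → ℝ := fun z => (moved Φ σ z).2 with hHdef
  have hmv : ∀ s ∈ Set.Icc (0 : ℝ) 1, ContDiffAt ℝ ∞ (moved Φ σ) (s, q) := fun s hs =>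
    contDiffAt_moved hO hΦ hσ (hsub ⟨hs, hq⟩)
  have hφ : ∀ s ∈ Set.Icc (0 : ℝ) 1, ContDiffAt ℝ ∞ φ (s, q) := fun s hs => (hmv s hs).fst
  have hH : ∀ s ∈ Set.Icc (0 : ℝ) 1, ContDiffAt ℝ ∞ H (s, q) := fun s hs => (hmv s hs).snd
  have hsrc : ∀ᶠ a in 𝓝 q, (a, σ a) ∈ e.source :=
    (tendsto_graph hσ).eventually (e.open_source.mem_nhds hq)
  have hode : ∀ᶠ a in 𝓝 q, ∀ s ∈ Set.Icc (0 : ℝ) 1,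
      HasDerivAt (fun r => φ (r, a)) (V (φ (s, a))) s ∧
      HasDerivAt (fun r => H (r, a)) (ψ (φ (s, a))) s := by
    filter_upwards [hsrc] with a ha s hs
    have := (hfl _ ha).2.2 s hs
    exact ⟨this.fst, this.snd⟩
  have hzero : ∀ᶠ a in 𝓝 q, φ (0, a) = a ∧ H (0, a) = σ a := by
    filter_upwards [hsrc] with a ha
    have := (hfl _ ha).1
    exact ⟨congrArg Prod.fst this, congrArg Prod.snd this⟩
  have hone : ∀ᶠ a in 𝓝 q, e (a, σ a) = (φ (1, a), H (1, a)) := by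
    filter_upwards [hsrc] with a ha
    exact (hfl _ ha).2.1.symm
  have hinj : ∀ s ∈ Set.Icc (0 : ℝ) 1, ∀ v, dd ((0 : ℝ), v) φ (s, q) = 0 → v = 0 :=
    fun s hs v hv => variation_injective hV hφ (hode.mono fun a ha r hr => (ha r hr).1)
      (hzero.mono fun a ha => ha.1) hs hv
  have hmap := fun s hs => map_nhds_of_immersive (hφ s hs) (hinj s hs)
  choose! S hS1 hS2 using fun s hs => exists_moving_family (hφ s hs) (hH s hs) (hinj s hs)
  have hpde : ∀ s ∈ Set.Icc (0 : ℝ) 1, ∀ᶠ b in 𝓝 (φ (s, q)), along V (S s) (s, b) = ψ b := by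
    intro s hs
    have hd := (tendsto_slice s (φ (s, q))).eventually (hS1 s hs).eventually_differentiableAt
    rw [← hmap s hs, Filter.eventually_map] at hd ⊢
    filter_upwards [hd, hode, (tendsto_slice s q).eventually (hS2 s hs).eventually_nhds]
      with a hda hoa hSa
    obtain ⟨o1, o2⟩ := hoa s hs
    have hcurve : HasDerivAt (fun r => (r, φ (r, a))) ((1 : ℝ), V (φ (s, a))) s :=
      (hasDerivAt_id s).prodMk o1
    have h1 := (show HasFDerivAt (S s) (fderiv ℝ (S s) (s, φ (s, a)))
      ((fun r => (r, φ (r, a))) s) from hda.hasFDerivAt).comp_hasDerivAt s hcurve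
    have h2 : Filter.Tendsto (fun r : ℝ => (r, a)) (𝓝 s) (𝓝 (s, a)) :=
      (Continuous.prodMk_left a).tendsto s
    exact h1.unique (o2.congr_of_eventuallyEq (h2.eventually hSa))
  set K : ℝ → ℝ := fun s => I (jet (fun b => S s (s, b)) (φ (s, q))) with hK
  have hder : ∀ s ∈ Set.Icc (0 : ℝ) 1, HasDerivWithinAt K 0 (Set.Icc 0 1) s := by
    intro s hs
    have h1 := hasDerivAt_jet hV hψ (c := fun r => φ (r, q)) (hode.self_of_nhds s hs).1
      (hS1 s hs) (hpde s hs)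
    have h2 := (hI _).hasFDerivAt.comp_hasDerivAt s h1
    rw [hinv] at h2
    refine h2.hasDerivWithinAt.congr_of_eventuallyEq ?_ rfl
    have h3 : Filter.Tendsto (fun r : ℝ => (r, q)) (𝓝 s) (𝓝 (s, q)) :=
      (Continuous.prodMk_left q).tendsto s
    filter_upwards [nhdsWithin_le_nhds (h3.eventually (hS2 s hs).eventually_nhds),
      self_mem_nhdsWithin] with r hr hrI
    simp only [hK, Function.comp_apply]
    congr 1
    refine jet_congr ?_
    rw [← hmap r hrI, Filter.EventuallyEq, Filter.eventually_map]
    filter_upwards [(tendsto_slice r q).eventually hr, (tendsto_slice r q).eventually (hS2 r hrI)]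
      with a h4 h5
    rw [h4, h5]
  have hconst : K 1 = K 0 :=
    constant_of_has_deriv_right_zero (a := (0 : ℝ)) (b := 1)
      (fun s hs => (hder s hs).continuousWithinAt)
      (fun s hs => ((hder s ⟨hs.1, hs.2.le⟩).mono_of_mem_nhdsWithin
        (Icc_mem_nhdsGE_of_mem hs))) 1 ⟨zero_le_one, le_rfl⟩
  have h0 : (0 : ℝ) ∈ Set.Icc (0 : ℝ) 1 := ⟨le_rfl, zero_le_one⟩
  have h1 : (1 : ℝ) ∈ Set.Icc (0 : ℝ) 1 := ⟨zero_le_one, le_rfl⟩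
  have he1 : (e (q, σ q)).1 = φ (1, q) := congrArg Prod.fst hone.self_of_nhds
  refine ⟨fun b => S 1 (1, b), ?_, ?_, ?_, ?_⟩
  · rw [he1]
    exact (hS1 1 h1).comp _ (contDiffAt_const.prodMk contDiffAt_id)
  · filter_upwards [hone, (tendsto_slice 1 q).eventually (hS2 1 h1)] with a ha1 ha2
    rw [ha1, ha2]
  · rw [he1, ← hmap 1 h1]
    exact Filter.map_congr (hone.mono fun a ha => congrArg Prod.fst ha)
  · rw [he1]
    refine hconst.trans ?_
    have h00 : φ (0, q) = q := hzero.self_of_nhds.1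
    simp only [hK]
    rw [h00]
    congr 1
    refine jet_congr ?_
    filter_upwards [hzero, (tendsto_slice 0 q).eventually (hS2 0 h0)] with a ha1 ha2
    rw [← ha1.2, ← ha2, ha1.1]

/-- A function of jets that is annihilated by the prolonged vector fields of a Lie algebra of
projectable vector fields is invariant under its pseudogroup. -/
theorem isInvariant_pseudogroup {𝔤 : Set (J0 → J0)} {I : J2 → ℝ} (hI : Differentiable ℝ I)
    (hsmul : ∀ X ∈ 𝔤, ∀ r : ℝ, r • X ∈ 𝔤)
    (h : ∀ X ∈ 𝔤, ∃ V ψ, ContDiff ℝ ∞ V ∧ ContDiff ℝ ∞ ψ ∧ X = addVertical V ψ ∧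
      ∀ p, fderiv ℝ I p (prol V ψ p) = 0) :
    IsInvariant (pseudogroup 𝔤) I := by
  refine (isInvariant_preservingGroupoid I).mono (sInf_le fun X hX τ e he => ?_)
  have key : ∀ X ∈ 𝔤, ∀ e, IsFlowMap X τ e → Preserves I e := by
    intro X hX e he
    obtain ⟨V, ψ, hV, hψ, hXV, hinv⟩ := h _ (hsmul X hX τ)
    exact preserves_of_isFlowMap hI hV hψ hinv (hXV ▸ he.rescale)
  refine ⟨key X hX e he, key (-X) ?_ _ he.symm⟩
  simpa using hsmul X hX (-1)

/-! ### Local invariants -/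

/-- The vector field `V + ψ ∂_u` is constant along its own straight trajectories. -/
structure IsStraight (V : TM → TM) (ψ : TM → ℝ) : Prop where
  smooth_field : ContDiff ℝ ∞ V
  smooth_vertical : ContDiff ℝ ∞ ψ
  field_shift : ∀ q (s : ℝ), V (q + s • V q) = V q
  vertical_shift : ∀ q (s : ℝ), ψ (q + s • V q) = ψ q

/-- The flow of a straight vector field. -/
def straightFlow {V : TM → TM} {ψ : TM → ℝ} (h : IsStraight V ψ) (s : ℝ) : J0 ≃ₜ J0 where
  toFun w := w + s • addVertical V ψ w
  invFun w := w + (-s) • addVertical V ψ w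
  left_inv w := by
    have h1 := h.field_shift w.1 s
    have h2 := h.vertical_shift w.1 s
    simp only [addVertical, Prod.fst_add, Prod.smul_fst, h1, h2]
    module
  right_inv w := by
    have h1 := h.field_shift w.1 (-s)
    have h2 := h.vertical_shift w.1 (-s)
    simp only [addVertical, Prod.fst_add, Prod.smul_fst, h1, h2]
    module
  continuous_toFun := by
    have h1 := h.smooth_field.continuous
    have h2 := h.smooth_vertical.continuous
    unfold addVertical
    fun_prop
  continuous_invFun := by
    have h1 := h.smooth_field.continuous
    have h2 := h.smooth_vertical.continuous
    unfold addVertical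
    fun_prop

theorem contDiff_addVertical {V : TM → TM} {ψ : TM → ℝ} (hV : ContDiff ℝ ∞ V)
    (hψ : ContDiff ℝ ∞ ψ) : ContDiff ℝ ∞ (addVertical V ψ) :=
  (hV.comp contDiff_fst).prodMk (hψ.comp contDiff_fst)

theorem isFlowMap_straightFlow {V : TM → TM} {ψ : TM → ℝ} (h : IsStraight V ψ) (ε s : ℝ) :
    IsFlowMap (ε • addVertical V ψ) s (straightFlow h (s * ε)).toOpenPartialHomeomorph := by
  have hX := contDiff_addVertical h.smooth_field h.smooth_vertical
  refine ⟨?_, Set.univ, fun z => z.2 + (z.1 * ε) • addVertical V ψ z.2, isOpen_univ,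
    Set.subset_univ _, ?_, fun w _ => ⟨by simp, rfl, fun r _ => ?_⟩⟩
  · have : ContDiff ℝ ∞ fun w : J0 => w + (-(s * ε)) • addVertical V ψ w :=
      contDiff_id.add (hX.const_smul _)
    exact this.contDiffOn
  · have : ContDiff ℝ ∞ fun z : ℝ × J0 => z.2 + (z.1 * ε) • addVertical V ψ z.2 :=
      contDiff_snd.add ((contDiff_fst.mul contDiff_const).smul (hX.comp contDiff_snd))
    exact this.contDiffOn
  · have h1 := h.field_shift w.1 (r * ε)
    have h2 := h.vertical_shift w.1 (r * ε)
    have h3 : addVertical V ψ (w + (r * ε) • addVertical V ψ w) = addVertical V ψ w := by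
      simp only [addVertical, Prod.fst_add, Prod.smul_fst, h1, h2]
    simp only [Pi.smul_apply, h3]
    simpa using (((hasDerivAt_id r).mul_const ε).smul_const (addVertical V ψ w)).const_add w

/-! ### Rules for partial derivatives -/

section Rules

variable {n : ℕ}

theorem pd_fun_add {f g : (Fin n → ℝ) → ℝ} (hf : Differentiable ℝ f) (hg : Differentiable ℝ g)
    (i : Fin n) : pd i (fun q => f q + g q) = fun q => pd i f q + pd i g q := by
  funext x
  simp only [pd]
  rw [fderiv_fun_add (hf x) (hg x)]
  rfl

theorem pd_fun_sub {f g : (Fin n → ℝ) → ℝ} (hf : Differentiable ℝ f) (hg : Differentiable ℝ g)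
    (i : Fin n) : pd i (fun q => f q - g q) = fun q => pd i f q - pd i g q :=
  funext fun x => pd_sub_apply (hf x) (hg x) i

theorem pd_fun_mul {f g : (Fin n → ℝ) → ℝ} (hf : Differentiable ℝ f) (hg : Differentiable ℝ g)
    (i : Fin n) : pd i (fun q => f q * g q) = fun q => f q * pd i g q + g q * pd i f q :=
  funext fun x => pd_mul_apply (hf x) (hg x) i

theorem pd_fun_neg (f : (Fin n → ℝ) → ℝ) (i : Fin n) :
    pd i (fun q => -f q) = fun q => -pd i f q := by
  funext x
  simp only [pd]
  rw [fderiv_fun_neg]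
  rfl

theorem pd_fun_const (c : ℝ) (i : Fin n) : pd i (fun _ => c) = fun _ => 0 := by
  funext x
  simp [pd]

theorem pd_fun_coord (i j : Fin n) : pd i (fun q => q j) = fun _ => if j = i then 1 else 0 := by
  funext x
  have : HasFDerivAt (fun q : Fin n → ℝ => q j) (ContinuousLinearMap.proj (R := ℝ) j) x :=
    hasFDerivAt_apply j x
  simp [pd, this.fderiv, Pi.single_apply]

end Rules

/-- Every two-jet is the jet of a quadratic polynomial. -/
theorem exists_isJetOf (p : J2) : ∃ σ : TM → ℝ, ContDiff ℝ ∞ σ ∧ IsJetOf p σ := by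
  let L : Fin 4 → TM → ℝ := fun i q => p.u1 i + ∑ j, p.u2 i j * (1 / 2 * (q j - p.1 j))
  let σ : TM → ℝ := fun q => p.2.1 + ∑ i, L i q * (q i - p.1 i)
  have hL : ∀ i, ContDiff ℝ ∞ (L i) := fun i => by fun_prop
  have hσ : ContDiff ℝ ∞ σ := by fun_prop
  have hcoord : ∀ (k j : Fin 4) (c : ℝ), pd k (fun q : TM => q j - c) =
      fun _ => if j = k then 1 else 0 := fun k j c => by
    rw [pd_fun_sub (by fun_prop) (by fun_prop), pd_fun_coord, pd_fun_const]
    simp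
  have hLd : ∀ k i q, pd k (L i) q = 1 / 2 * p.u2 i k := fun k i q => by
    have hd : ∀ j, Differentiable ℝ fun q : TM => p.u2 i j * (1 / 2 * (q j - p.1 j)) :=
      fun j => by fun_prop
    simp only [L]
    rw [pd_fun_add (by fun_prop) (by fun_prop), pd_fun_const]
    simp only [zero_add]
    rw [pd_sum_apply fun j _ => hd j q]
    have : ∀ j, pd k (fun q : TM => p.u2 i j * (1 / 2 * (q j - p.1 j))) q =
        if j = k then 1 / 2 * p.u2 i j else 0 := fun j => by
      rw [pd_fun_mul (by fun_prop) (by fun_prop), pd_fun_mul (by fun_prop) (by fun_prop), hcoord,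
        pd_fun_const, pd_fun_const]
      split_ifs <;> simp; ring
    rw [Finset.sum_congr rfl fun j _ => this j]
    simp
  have hσd : ∀ k, pd k σ = fun q => p.u1 k + ∑ j, p.u2 k j * (q j - p.1 j) := fun k => by
    funext q
    have hd : ∀ j, Differentiable ℝ fun q : TM => L j q * (q j - p.1 j) :=
      fun j => (((hL j).differentiable (by simp))).mul (by fun_prop)
    simp only [σ]
    rw [pd_fun_add (by fun_prop) (Differentiable.fun_sum fun j _ => hd j), pd_fun_const]
    simp only [zero_add]
    rw [pd_sum_apply fun j _ => hd j q]
    have : ∀ j, pd k (fun q : TM => L j q * (q j - p.1 j)) q =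
        (if j = k then L j q else 0) + 1 / 2 * p.u2 k j * (q j - p.1 j) := fun j => by
      rw [pd_mul_apply ((hL j).differentiable (by simp) q) (by fun_prop), hcoord, hLd]
      have : p.u2 j k = p.u2 k j := by simp only [J2.u2, Sym2.eq_swap]
      rw [this]
      split_ifs <;> simp <;> ring
    simp only [this, Finset.sum_add_distrib, Finset.sum_ite_eq', Finset.mem_univ, if_true, L]
    rw [add_assoc, ← Finset.sum_add_distrib]
    congr 1
    exact Finset.sum_congr rfl fun j _ => by ring
  refine ⟨σ, hσ, hσ.contDiffAt, by simp [σ], fun i => by simp [hσd], fun i j => ?_⟩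
  rw [hσd, pd_fun_add (by fun_prop) (by fun_prop), pd_fun_const]
  simp only [zero_add]
  rw [pd_sum_apply fun k _ => by fun_prop]
  have : ∀ k, pd j (fun q : TM => p.u2 i k * (q k - p.1 k)) p.1 =
      if k = j then p.u2 i k else 0 := fun k => by
    rw [pd_fun_mul (by fun_prop) (by fun_prop), hcoord, pd_fun_const]
    simp
  simp [this]

/-- The differential of a local invariant annihilates prolonged straight vector fields. -/
theorem fderiv_prol_eq_zero {𝔤 : Set (J0 → J0)} {U : Set J2} {F : J2 → ℝ} (hU : IsOpen U)
    (hF : ContDiffOn ℝ ∞ F U) (hinv : IsLocalInvariantOn 𝔤 U F) {V : TM → TM} {ψ : TM → ℝ}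
    (hX : IsStraight V ψ) (hmem : ∀ ε : ℝ, ε • addVertical V ψ ∈ 𝔤) {p : J2} (hp : p ∈ U) :
    fderiv ℝ F p (prol V ψ p) = 0 := by
  have hV := hX.smooth_field
  have hψ := hX.smooth_vertical
  obtain ⟨σ, hσ, hpσ⟩ := exists_isJetOf p
  let S : ℝ × TM → ℝ := fun x => σ (x.2 - x.1 • V x.2) + x.1 * ψ x.2
  have hS : ContDiff ℝ ∞ S :=
    (hσ.comp (contDiff_snd.sub (contDiff_fst.smul (hV.comp contDiff_snd)))).add
      (contDiff_fst.mul (hψ.comp contDiff_snd))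
  let c : ℝ → TM := fun s => p.1 + s • V p.1
  let P : ℝ → J2 := fun s => jet (fun b => S (s, b)) (c s)
  have hSc : ∀ s a, S (s, a + s • V a) = σ a + s * ψ a := fun s a => by
    simp only [S, hX.field_shift, hX.vertical_shift, add_sub_cancel_right]
  have hc0 : c 0 = p.1 := by simp [c]
  have hP0 : P 0 = p := by
    rw [hpσ.eq_jet]
    simp only [P, hc0]
    exact congrArg (fun f => jet f p.1) (funext fun b => by simp [S])
  have hc : HasDerivAt c (V (c 0)) 0 := by
    rw [hc0]
    simpa [c] using (((hasDerivAt_id (0 : ℝ)).smul_const (V p.1)).const_add p.1)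
  have hpde : ∀ b, along V S (0, b) = ψ b := fun b => by
    have h1 : HasDerivAt (fun s : ℝ => (s, b + s • V b)) ((1 : ℝ), V b) 0 := by
      simpa using (hasDerivAt_id (0 : ℝ)).prodMk
        (((hasDerivAt_id (0 : ℝ)).smul_const (V b)).const_add b)
    have h2 : HasFDerivAt S (fderiv ℝ S (0, b)) ((fun s : ℝ => (s, b + s • V b)) 0) := by
      simpa using (hS.differentiable (by simp) (0, b)).hasFDerivAt
    have h3 := h2.comp_hasDerivAt (0 : ℝ) h1
    have h4 : HasDerivAt (S ∘ fun s : ℝ => (s, b + s • V b)) (ψ b) 0 := by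
      have : (S ∘ fun s : ℝ => (s, b + s • V b)) = fun s => σ b + s * ψ b :=
        funext fun s => hSc s b
      rw [this]
      simpa using ((hasDerivAt_id (0 : ℝ)).mul_const (ψ b)).const_add (σ b)
    exact h3.unique h4
  have hPd : HasDerivAt P (prol V ψ p) 0 := by
    have := hasDerivAt_jet hV hψ hc hS.contDiffAt (Filter.Eventually.of_forall hpde)
    change HasDerivAt P (prol V ψ (P 0)) 0 at this
    rwa [hP0] at this
  have hnear : ∀ᶠ s in 𝓝 (0 : ℝ), P s ∈ U :=
    hPd.continuousAt.eventually (by rw [hP0]; exact hU.mem_nhds hp)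
  obtain ⟨δ, hδ, hball⟩ := Metric.eventually_nhds_iff.1 hnear
  have hconst : ∀ᶠ ε in 𝓝 (0 : ℝ), F (P ε) = F p := by
    refine Metric.eventually_nhds_iff.2 ⟨δ, hδ, fun ε hε => ?_⟩
    have := hinv _ (hmem ε) (fun s => P (s * ε)) fun s hs => ⟨hball ?_, _,
      isFlowMap_straightFlow hX ε s, ?_⟩
    · simpa [hP0] using this
    · rw [Real.dist_eq, sub_zero] at hε ⊢
      rw [abs_mul, abs_of_nonneg hs.1]
      exact lt_of_le_of_lt (mul_le_of_le_one_left (abs_nonneg _) hs.2) hε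
    · have hflow : ∀ a, straightFlow hX (s * ε) (a, σ a) =
          (a + (s * ε) • V a, σ a + (s * ε) * ψ a) := fun a => rfl
      simp only [zero_mul, hP0]
      refine ⟨trivial, ?_, σ, fun b => S (s * ε, b), hpσ, ?_, ?_⟩
      · have h0 : p.toJ0 = (p.1, σ p.1) := Prod.ext rfl hpσ.2.1.symm
        rw [h0]
        refine (hflow p.1).trans ?_
        rw [← hSc]
        rfl
      · exact isJetOf_jet (hS.comp (contDiff_const.prodMk contDiff_id)).contDiffAt
      · exact Filter.Eventually.of_forall fun a => (hSc (s * ε) a).symm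
  have hFd : HasFDerivAt F (fderiv ℝ F p) (P 0) := by
    rw [hP0]
    exact ((hF.contDiffAt (hU.mem_nhds hp)).differentiableAt (by simp)).hasFDerivAt
  exact (hFd.comp_hasDerivAt (0 : ℝ) hPd).unique
    ((hasDerivAt_const (0 : ℝ) (F p)).congr_of_eventuallyEq hconst)

/-! ### Functional dependence -/

section Dependence

variable {E : Type*} [NormedAddCommGroup E] [NormedSpace ℝ E]

theorem range_pi_eq_top {n : ℕ} {L : Fin n → E →L[ℝ] ℝ} (h : LinearIndependent ℝ L) :
    (ContinuousLinearMap.pi L : E →L[ℝ] Fin n → ℝ).range = ⊤ := by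
  by_contra hne
  obtain ⟨f, hf0, hf⟩ := Submodule.exists_le_ker_of_lt_top _ (lt_top_iff_ne_top.2 hne)
  have hfe : ∀ v : Fin n → ℝ, f v = ∑ k, v k * f (Pi.single k 1) := fun v => by
    conv_lhs => rw [pi_eq_sum_univ' v, map_sum]
    exact Finset.sum_congr rfl fun k _ => by
      rw [map_smul, smul_eq_mul]
  have hz : ∑ k, f (Pi.single k 1) • L k = 0 := by
    ext x
    have : f (fun k => L k x) = 0 := hf ⟨x, rfl⟩
    rw [hfe] at this
    simpa [mul_comm] using this
  have := Fintype.linearIndependent_iff.1 h _ hz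
  apply hf0
  ext k
  simp [this]

theorem dense_ne_zero {D : E → ℝ} (hD : ContDiff ℝ ω D) {p : E} (hp : D p ≠ 0) :
    Dense {x | D x ≠ 0} := by
  by_contra hne
  rw [dense_iff_inter_open] at hne
  push Not at hne
  obtain ⟨U, hU, ⟨x, hx⟩, hUx⟩ := hne
  have han : AnalyticOnNhd ℝ D Set.univ := fun y _ => (hD.contDiffAt).analyticAt
  have hev : D =ᶠ[𝓝 x] fun _ => 0 := by
    filter_upwards [hU.mem_nhds hx] with y hy
    by_contra hy0
    exact Set.eq_empty_iff_forall_notMem.1 hUx y ⟨hy, hy0⟩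
  exact hp (han.eqOn_of_preconnected_of_eventuallyEq (fun y _ => analyticAt_const)
    isPreconnected_univ (Set.mem_univ x) hev (Set.mem_univ p))

/-- A smooth function whose differential is a combination of the independent differentials of
`I 0, …, I (n - 1)` is locally a smooth function of them. -/
theorem exists_eq_comp [FiniteDimensional ℝ E] {n : ℕ} {I : Fin n → E → ℝ}
    (hI : ∀ k, ContDiff ℝ ∞ (I k)) {p : E}
    (hind : LinearIndependent ℝ fun k => fderiv ℝ (I k) p) {F : E → ℝ} (hF : ContDiffAt ℝ ∞ F p)
    (hspan : ∀ᶠ p' in 𝓝 p,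
      fderiv ℝ F p' ∈ Submodule.span ℝ (Set.range fun k => fderiv ℝ (I k) p')) :
    ∃ f : (Fin n → ℝ) → ℝ, ContDiffAt ℝ ∞ f (fun k => I k p) ∧
      ∀ᶠ p' in 𝓝 p, F p' = f fun k => I k p' := by
  set D : E →L[ℝ] Fin n → ℝ := ContinuousLinearMap.pi fun k => fderiv ℝ (I k) p with hD
  have hsurj : D.range = ⊤ := range_pi_eq_top hind
  obtain ⟨π, hπ⟩ := Submodule.ClosedComplemented.of_finiteDimensional D.ker
  have hπr : π.range = ⊤ := LinearMap.range_eq_top.2 fun x => ⟨x, hπ x⟩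
  have hcompl : IsCompl D.ker π.ker := LinearMap.isCompl_of_proj hπ
  let Le : E ≃L[ℝ] (Fin n → ℝ) × D.ker := D.equivProdOfSurjectiveOfIsCompl π hsurj hπr hcompl
  let Ψ : E → (Fin n → ℝ) × D.ker := fun x => (fun k => I k x, π x)
  have hΨ : ContDiff ℝ ∞ Ψ := (contDiff_pi.2 hI).prodMk π.contDiff
  have hΨd : HasFDerivAt Ψ (Le : E →L[ℝ] (Fin n → ℝ) × D.ker) p := by
    refine HasFDerivAt.prodMk ?_ π.hasFDerivAt
    exact hasFDerivAt_pi.2 fun k => ((hI k).differentiable (by simp) p).hasFDerivAt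
  have hst := hΨ.contDiffAt.hasStrictFDerivAt' hΨd (by simp)
  set loc := hst.localInverse Ψ Le p with hloc
  have hlocd : ContDiffAt ℝ ∞ loc (Ψ p) := hΨ.contDiffAt.to_localInverse hΨd (by simp)
  have hlocp : loc (Ψ p) = p := hst.localInverse_apply_image
  have hright : ∀ᶠ y in 𝓝 (Ψ p), Ψ (loc y) = y := hst.eventually_right_inverse
  have hleft : ∀ᶠ x in 𝓝 p, loc (Ψ x) = x := hst.eventually_left_inverse
  let G : (Fin n → ℝ) × D.ker → ℝ := F ∘ loc
  have hG : ContDiffAt ℝ ∞ G (Ψ p) := ContDiffAt.comp _ (by rw [hlocp]; exact hF) hlocd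
  have hloct : Filter.Tendsto loc (𝓝 (Ψ p)) (𝓝 p) := by
    have := hlocd.continuousAt
    rwa [ContinuousAt, hlocp] at this
  have hvert : ∀ᶠ y in 𝓝 (Ψ p), DifferentiableAt ℝ G y ∧
      ∀ w : D.ker, fderiv ℝ G y (0, w) = 0 := by
    filter_upwards [hright.eventually_nhds, hlocd.eventually_differentiableAt,
      hloct.eventually hspan, hloct.eventually hF.eventually_differentiableAt]
      with y hy hyl hys hyF
    have hGd : HasFDerivAt G ((fderiv ℝ F (loc y)) ∘L (fderiv ℝ loc y)) y :=
      hyF.hasFDerivAt.comp y hyl.hasFDerivAt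
    refine ⟨hGd.differentiableAt, fun w => ?_⟩
    rw [hGd.fderiv, ContinuousLinearMap.comp_apply]
    obtain ⟨a, ha⟩ := (Submodule.mem_span_range_iff_exists_fun ℝ).1 hys
    rw [← ha]
    simp only [sum_apply, smul_apply]
    refine Finset.sum_eq_zero fun k _ => ?_
    have h1 : HasFDerivAt (I k ∘ loc) ((fderiv ℝ (I k) (loc y)) ∘L (fderiv ℝ loc y)) y :=
      ((hI k).differentiable (by simp) (loc y)).hasFDerivAt.comp y hyl.hasFDerivAt
    have h2 : (I k ∘ loc) =ᶠ[𝓝 y] fun y => y.1 k :=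
      hy.mono fun y' hy' => congrFun (congrArg Prod.fst hy') k
    have h3 : HasFDerivAt (fun y : (Fin n → ℝ) × D.ker => y.1 k)
        ((ContinuousLinearMap.proj (R := ℝ) k) ∘L ContinuousLinearMap.fst ℝ (Fin n → ℝ) D.ker) y :=
      ((ContinuousLinearMap.proj (R := ℝ) k) ∘L
        ContinuousLinearMap.fst ℝ (Fin n → ℝ) D.ker).hasFDerivAt
    have h4 := congrArg (fun L => L ((0 : Fin n → ℝ), w)) (h1.unique (h3.congr_of_eventuallyEq h2))
    simp only [ContinuousLinearMap.comp_apply] at h4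
    rw [h4]
    simp
  refine ⟨fun v => G (v, π p), ?_, ?_⟩
  · exact ContDiffAt.comp (g := G) (f := fun v => (v, π p)) (fun k => I k p) hG
      (contDiffAt_id.prodMk contDiffAt_const)
  · obtain ⟨ε, hε, hball⟩ := Metric.eventually_nhds_iff_ball.1 hvert
    have hnear : ∀ᶠ x in 𝓝 p, Ψ x ∈ Metric.ball (Ψ p) ε :=
      hΨ.continuous.continuousAt.eventually (Metric.ball_mem_nhds _ hε)
    filter_upwards [hnear, hleft] with x hx hxl
    rw [← ball_prod_same] at hx hball
    obtain ⟨hx1, hx2⟩ := hx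
    have hin : ∀ w ∈ Metric.ball (Ψ p).2 ε, HasFDerivAt (fun w => G ((Ψ x).1, w))
        (0 : D.ker →L[ℝ] ℝ) w := fun w hw => by
      obtain ⟨hd, hz⟩ := hball ((Ψ x).1, w) ⟨hx1, hw⟩
      have := hd.hasFDerivAt.comp w (hasFDerivAt_prodMk_right (Ψ x).1 w)
      convert! this using 1
      ext v
      simp [hz]
    have hcst := Metric.isOpen_ball.is_const_of_fderiv_eq_zero
      (convex_ball (Ψ p).2 ε).isPreconnected
      (fun w hw => (hin w hw).differentiableAt.differentiableWithinAt)
      (fun w hw => (hin w hw).fderiv) hx2 (Metric.mem_ball_self hε)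
    calc F x = G (Ψ x) := by simp only [G, Function.comp_apply, hxl]
      _ = G ((Ψ x).1, (Ψ x).2) := rfl
      _ = _ := hcst

end Dependence

/-! ### Derivatives of functions on the surface -/

/-- The derivative `∂_t^i ∂_z^j A`, as a function on `TM`. -/
def jp (A : M → ℝ) (i j : ℕ) : TM → ℝ := pull ((pd 1)^[j] ((pd 0)^[i] A))

theorem pull_eq_jp (A : M → ℝ) : pull A = jp A 0 0 := rfl

theorem _root_.ContDiff.pd {n : ℕ} {f : (Fin n → ℝ) → ℝ} (h : ContDiff ℝ ∞ f) (i : Fin n) :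
    ContDiff ℝ ∞ (pd i f) := contDiff_iff_contDiffAt.2 fun _ => h.contDiffAt.pd i

theorem _root_.ContDiff.pd_iterate {n : ℕ} {f : (Fin n → ℝ) → ℝ} (h : ContDiff ℝ ∞ f) (i : Fin n)
    (k : ℕ) : ContDiff ℝ ∞ ((Plebanski.pd i)^[k] f) := by
  induction k with
  | zero => exact h
  | succ k ih => rw [Function.iterate_succ_apply']; exact ih.pd i

theorem pd_pd_iterate {n : ℕ} {f : (Fin n → ℝ) → ℝ} (h : ContDiff ℝ ∞ f) (i j : Fin n) (k : ℕ) :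
    pd i ((pd j)^[k] f) = (pd j)^[k] (pd i f) := by
  induction k with
  | zero => rfl
  | succ k ih =>
    rw [Function.iterate_succ_apply', Function.iterate_succ_apply', ← ih]
    exact funext fun x => pd_comm (h.pd_iterate j k).contDiffAt i j

theorem contDiff_pull {B : M → ℝ} (hB : ContDiff ℝ ∞ B) : ContDiff ℝ ∞ (pull B) :=
  hB.comp (contDiff_pi.2 fun i => by fin_cases i <;> exact contDiff_apply ..)

theorem contDiff_jp {A : M → ℝ} (hA : ContDiff ℝ ∞ A) (i j : ℕ) : ContDiff ℝ ∞ (jp A i j) :=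
  contDiff_pull ((hA.pd_iterate 0 i).pd_iterate 1 j)

@[fun_prop]
theorem differentiable_jp {A : M → ℝ} (hA : ContDiff ℝ ∞ A) (i j : ℕ) :
    Differentiable ℝ (jp A i j) := (contDiff_jp hA i j).differentiable (by simp)

theorem fderiv_pull {B : M → ℝ} (hB : ContDiff ℝ ∞ B) (q v : TM) :
    fderiv ℝ (pull B) q v = fderiv ℝ B ![q ct, q cz] ![v ct, v cz] := by
  let P : TM →L[ℝ] M := ContinuousLinearMap.pi
    ![ContinuousLinearMap.proj (R := ℝ) ct, ContinuousLinearMap.proj (R := ℝ) cz]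
  have hP : ∀ w : TM, P w = ![w ct, w cz] := fun w => by
    ext i
    fin_cases i <;> rfl
  have h0 : pull B = B ∘ P := funext fun w => by rw [Function.comp_apply, hP]; rfl
  rw [h0, fderiv_comp q (hB.differentiable (by simp) _) P.differentiableAt, P.fderiv]
  simp [hP]

theorem pd_pull {B : M → ℝ} (hB : ContDiff ℝ ∞ B) :
    pd ct (pull B) = pull (pd 0 B) ∧ pd cz (pull B) = pull (pd 1 B) ∧
      pd cx (pull B) = (fun _ => 0) ∧ pd cy (pull B) = fun _ => 0 := by
  refine ⟨?_, ?_, ?_, ?_⟩ <;> funext q <;> simp only [pd, fderiv_pull hB, pull]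
  · congr 1; ext i; fin_cases i <;> simp
  · congr 1; ext i; fin_cases i <;> simp
  · rw [show (![(Pi.single cx 1 : TM) ct, (Pi.single cx 1 : TM) cz] : M) = 0 by
      ext i; fin_cases i <;> rfl, map_zero]
  · rw [show (![(Pi.single cy 1 : TM) ct, (Pi.single cy 1 : TM) cz] : M) = 0 by
      ext i; fin_cases i <;> rfl, map_zero]

theorem pd_ct_jp {A : M → ℝ} (hA : ContDiff ℝ ∞ A) (i j : ℕ) :
    pd (0 : Fin 4) (jp A i j) = jp A (i + 1) j := by
  rw [jp, (pd_pull ((hA.pd_iterate 0 i).pd_iterate 1 j)).1, pd_pd_iterate (hA.pd_iterate 0 i), jp,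
    Function.iterate_succ_apply']

theorem pd_cz_jp {A : M → ℝ} (hA : ContDiff ℝ ∞ A) (i j : ℕ) :
    pd (1 : Fin 4) (jp A i j) = jp A i (j + 1) := by
  rw [jp, (pd_pull ((hA.pd_iterate 0 i).pd_iterate 1 j)).2.1, jp, Function.iterate_succ_apply']

theorem pd_cx_jp {A : M → ℝ} (hA : ContDiff ℝ ∞ A) (i j : ℕ) :
    pd (2 : Fin 4) (jp A i j) = fun _ => 0 :=
  (pd_pull ((hA.pd_iterate 0 i).pd_iterate 1 j)).2.2.1

theorem pd_cy_jp {A : M → ℝ} (hA : ContDiff ℝ ∞ A) (i j : ℕ) :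
    pd (3 : Fin 4) (jp A i j) = fun _ => 0 :=
  (pd_pull ((hA.pd_iterate 0 i).pd_iterate 1 j)).2.2.2

/-- The derivative `∂_t^i ∂_z^j ∇^k A`. -/
def jn (A : M → ℝ) : ℕ → ℕ → ℕ → TM → ℝ
  | 0, i, j => jp A i j
  | k + 1, i, j => fun q => q 2 * jn A k (i + 1) j q + q 3 * jn A k i (j + 1) q

/-- The derivative `∂_t^i ∂_z^j ζ₁(A)`. -/
def zj (A : M → ℝ) (i j : ℕ) : TM → ℝ := fun q =>
  q 0 * jp A (i + 1) j q + q 1 * jp A i (j + 1) q + ((i : ℝ) + j - 2) * jp A i j q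

theorem contDiff_jn {A : M → ℝ} (hA : ContDiff ℝ ∞ A) (k i j : ℕ) : ContDiff ℝ ∞ (jn A k i j) := by
  induction k generalizing i j with
  | zero => exact contDiff_jp hA i j
  | succ k ih =>
    exact ((contDiff_apply ℝ ℝ (2 : Fin 4)).mul (ih _ _)).add
      ((contDiff_apply ℝ ℝ (3 : Fin 4)).mul (ih _ _))

theorem contDiff_zj {A : M → ℝ} (hA : ContDiff ℝ ∞ A) (i j : ℕ) : ContDiff ℝ ∞ (zj A i j) :=
  (((contDiff_apply ℝ ℝ (0 : Fin 4)).mul (contDiff_jp hA _ _)).add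
    ((contDiff_apply ℝ ℝ (1 : Fin 4)).mul (contDiff_jp hA _ _))).add
      (contDiff_const.mul (contDiff_jp hA _ _))

@[fun_prop]
theorem differentiable_jn {A : M → ℝ} (hA : ContDiff ℝ ∞ A) (k i j : ℕ) :
    Differentiable ℝ (jn A k i j) := (contDiff_jn hA k i j).differentiable (by simp)

@[fun_prop]
theorem differentiable_zj {A : M → ℝ} (hA : ContDiff ℝ ∞ A) (i j : ℕ) :
    Differentiable ℝ (zj A i j) := (contDiff_zj hA i j).differentiable (by simp)

section

variable {A : M → ℝ} (hA : ContDiff ℝ ∞ A)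
include hA

theorem pd_zero_jn (k i j : ℕ) : pd (0 : Fin 4) (jn A k i j) = jn A k (i + 1) j := by
  induction k generalizing i j with
  | zero => exact pd_ct_jp hA i j
  | succ k ih =>
    simp only [jn]
    simp (disch := fun_prop) [pd_fun_add, pd_fun_mul, pd_fun_coord, ih]

theorem pd_one_jn (k i j : ℕ) : pd (1 : Fin 4) (jn A k i j) = jn A k i (j + 1) := by
  induction k generalizing i j with
  | zero => exact pd_cz_jp hA i j
  | succ k ih =>
    simp only [jn]
    simp (disch := fun_prop) [pd_fun_add, pd_fun_mul, pd_fun_coord, ih]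

theorem pd_two_jn_zero (i j : ℕ) : pd (2 : Fin 4) (jn A 0 i j) = fun _ => 0 := pd_cx_jp hA i j

theorem pd_three_jn_zero (i j : ℕ) : pd (3 : Fin 4) (jn A 0 i j) = fun _ => 0 := pd_cy_jp hA i j

theorem pd_two_jn (k i j : ℕ) :
    pd (2 : Fin 4) (jn A (k + 1) i j) = fun q => ((k : ℝ) + 1) * jn A k (i + 1) j q := by
  induction k generalizing i j with
  | zero =>
    simp only [jn]
    simp (disch := fun_prop) [pd_fun_add, pd_fun_mul, pd_fun_coord, pd_cx_jp]
  | succ k ih =>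
    rw [jn]
    simp (disch := fun_prop) only [pd_fun_add, pd_fun_mul, pd_fun_coord, ih]
    funext q
    simp [jn]
    ring

theorem pd_three_jn (k i j : ℕ) :
    pd (3 : Fin 4) (jn A (k + 1) i j) = fun q => ((k : ℝ) + 1) * jn A k i (j + 1) q := by
  induction k generalizing i j with
  | zero =>
    simp only [jn]
    simp (disch := fun_prop) [pd_fun_add, pd_fun_mul, pd_fun_coord, pd_cy_jp]
  | succ k ih =>
    rw [jn]
    simp (disch := fun_prop) only [pd_fun_add, pd_fun_mul, pd_fun_coord, ih]
    funext q
    simp [jn]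
    ring

theorem pd_zero_zj (i j : ℕ) : pd (0 : Fin 4) (zj A i j) = zj A (i + 1) j := by
  unfold zj
  simp (disch := fun_prop) [pd_fun_add, pd_fun_mul, pd_fun_coord, pd_fun_const, pd_ct_jp]
  funext q
  ring

theorem pd_one_zj (i j : ℕ) : pd (1 : Fin 4) (zj A i j) = zj A i (j + 1) := by
  unfold zj
  simp (disch := fun_prop) [pd_fun_add, pd_fun_mul, pd_fun_coord, pd_fun_const, pd_cz_jp]
  funext q
  ring

theorem pd_two_zj (i j : ℕ) : pd (2 : Fin 4) (zj A i j) = fun _ => 0 := by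
  unfold zj
  simp (disch := fun_prop) [pd_fun_add, pd_fun_mul, pd_fun_coord, pd_fun_const, pd_cx_jp]

theorem pd_three_zj (i j : ℕ) : pd (3 : Fin 4) (zj A i j) = fun _ => 0 := by
  unfold zj
  simp (disch := fun_prop) [pd_fun_add, pd_fun_mul, pd_fun_coord, pd_fun_const, pd_cy_jp]

theorem nabla_jn (k : ℕ) : nabla (jn A k 0 0) = jn A (k + 1) 0 0 := by
  unfold nabla
  simp only [ct, cz, cx, cy, pd_zero_jn hA, pd_one_jn hA]
  rfl

theorem zeta_eq_zj : zeta A = zj A 0 0 := by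
  funext q
  simp only [zeta, zj, ct, cz, pull_eq_jp, pd_ct_jp hA, pd_cz_jp hA]
  push_cast
  ring

theorem V0_eq : V0 A =
    fun q => ![jn A 0 0 1 q, -jn A 0 1 0 q, jn A 1 0 1 q, -jn A 1 1 0 q] := by
  funext q
  simp only [V0, ct, cz, cx, cy, pull_eq_jp, pd_ct_jp hA, pd_cz_jp hA, jn]
  simp only [mul_comm]

theorem V1_eq : V1 A = fun q => ![0, 0, jn A 0 0 1 q, -jn A 0 1 0 q] := by
  funext q
  simp only [V1, ct, cz, pull_eq_jp, pd_ct_jp hA, pd_cz_jp hA, jn]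

end

/-! ### The vector fields of the Lie algebras -/

/-- The part of a vector field of `𝔥` that is tangent to `TM`. -/
def fieldH (A : Fin 4 → M → ℝ) : TM → TM := fun q =>
  ![jn (A 0) 0 0 1 q, -jn (A 0) 0 1 0 q, jn (A 0) 1 0 1 q + jn (A 1) 0 0 1 q,
    -jn (A 0) 1 1 0 q - jn (A 1) 0 1 0 q]

/-- The vertical part of a vector field of `𝔥`. -/
def vertH (c₁ c₂ c₃ c₄ : ℝ) (A : Fin 4 → M → ℝ) : TM → ℝ := fun q =>
  c₁ / 6 * jn (A 0) 3 0 0 q + c₃ * zj (A 0) 0 0 q + c₁ / 2 * jn (A 1) 2 0 0 q +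
    c₂ * jn (A 1) 1 0 0 q + c₄ * jn (A 1) 0 0 0 q + c₁ * jn (A 2) 1 0 0 q +
    2 * c₂ * jn (A 2) 0 0 0 q + c₁ * jn (A 3) 0 0 0 q

theorem contDiff_fieldH {A : Fin 4 → M → ℝ} (hA : ∀ i, ContDiff ℝ ∞ (A i)) :
    ContDiff ℝ ∞ (fieldH A) := by
  refine contDiff_pi.2 fun i => ?_
  fin_cases i
  · exact contDiff_jn (hA 0) ..
  · exact (contDiff_jn (hA 0) ..).neg
  · exact (contDiff_jn (hA 0) ..).add (contDiff_jn (hA 1) ..)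
  · exact (contDiff_jn (hA 0) ..).neg.sub (contDiff_jn (hA 1) ..)

theorem contDiff_vertH (c₁ c₂ c₃ c₄ : ℝ) {A : Fin 4 → M → ℝ} (hA : ∀ i, ContDiff ℝ ∞ (A i)) :
    ContDiff ℝ ∞ (vertH c₁ c₂ c₃ c₄ A) := by
  have := fun i k => contDiff_jn (hA i) k 0 0
  have := contDiff_zj (hA 0) 0 0
  unfold vertH
  fun_prop

theorem mem_h_iff {c₁ c₂ c₃ c₄ : ℝ} {X : J0 → J0} : X ∈ h c₁ c₂ c₃ c₄ ↔
    ∃ A : Fin 4 → M → ℝ, (∀ i, ContDiff ℝ ∞ (A i)) ∧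
      X = addVertical (fieldH A) (vertH c₁ c₂ c₃ c₄ A) := by
  refine exists_congr fun A => and_congr_right fun hA => ?_
  suffices hatV0 c₁ c₃ (A 0) + hatV1 c₁ c₂ c₄ (A 1) + hatV2 c₁ c₂ (A 2) + hatV3 c₁ (A 3) =
      addVertical (fieldH A) (vertH c₁ c₂ c₃ c₄ A) by rw [this]
  funext w
  have hn : ∀ i, pull (A i) = jn (A i) 0 0 0 := fun i => rfl
  simp only [Pi.add_apply, hatV0, hatV1, hatV2, hatV3, addVertical, hn, nabla_jn (hA _),
    zeta_eq_zj (hA _), V0_eq (hA _), V1_eq (hA _), fieldH, vertH]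
  refine Prod.ext ?_ ?_
  · funext i
    fin_cases i <;> simp
    ring
  · simp
    ring

theorem jn_smul {A : M → ℝ} (r : ℝ) (k i j : ℕ) : jn (r • A) k i j = r • jn A k i j := by
  have hs : ∀ (f : M → ℝ) (i : Fin 2), pd i (r • f) = r • pd i f := fun f i => by
    funext q
    simp [pd, fderiv_const_smul_field]
  have hit : ∀ (f : M → ℝ) (i : Fin 2) (k : ℕ), (pd i)^[k] (r • f) = r • (pd i)^[k] f :=
    fun f i k => by
      induction k with
      | zero => rfl
      | succ k ih => rw [Function.iterate_succ_apply', Function.iterate_succ_apply', ih, hs]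
  induction k generalizing i j with
  | zero =>
    simp only [jn, jp, hit]
    rfl
  | succ k ih =>
    funext q
    simp only [jn, ih, Pi.smul_apply, smul_eq_mul]
    ring

theorem zj_smul {A : M → ℝ} (r : ℝ) (i j : ℕ) : zj (r • A) i j = r • zj A i j := by
  funext q
  have : ∀ i j, jp (r • A) i j = r • jp A i j := fun i j => jn_smul r 0 i j
  simp only [zj, this, Pi.smul_apply, smul_eq_mul]
  ring

theorem smul_addVertical_fieldH (c₁ c₂ c₃ c₄ r : ℝ) (A : Fin 4 → M → ℝ) :
    r • addVertical (fieldH A) (vertH c₁ c₂ c₃ c₄ A) =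
      addVertical (fieldH fun i => r • A i) (vertH c₁ c₂ c₃ c₄ fun i => r • A i) := by
  funext w
  simp only [addVertical, Pi.smul_apply, fieldH, vertH, jn_smul, zj_smul, smul_eq_mul]
  refine Prod.ext ?_ ?_
  · funext i
    fin_cases i <;> simp <;> ring
  · simp
    ring

theorem smul_mem_h {c₁ c₂ c₃ c₄ : ℝ} {X : J0 → J0} (hX : X ∈ h c₁ c₂ c₃ c₄) (r : ℝ) :
    r • X ∈ h c₁ c₂ c₃ c₄ := by
  rw [mem_h_iff] at hX ⊢
  obtain ⟨A, hA, rfl⟩ := hX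
  exact ⟨fun i => r • A i, fun i => contDiff_const.smul (hA i), smul_addVertical_fieldH ..⟩

theorem g1_eq_h : g1 = h (-1) 0 0 0 := by
  have hneg : ∀ A : M → ℝ, W2 A = hatV2 (-1) 0 (-A) ∧ W3 A = hatV3 (-1) (-A) := fun A => by
    have h1 : ∀ (i : Fin 4) , pd i (pull (-A)) = -pd i (pull A) := fun i => pd_fun_neg _ i
    constructor <;> funext w <;> refine Prod.ext rfl ?_
    · simp [W2, hatV2, addVertical, nabla, h1]
      ring
    · simp [W3, hatV3, addVertical, pull]
  have h01 : ∀ A : M → ℝ, W0 A = hatV0 (-1) 0 A ∧ W1 A = hatV1 (-1) 0 0 A := fun A => by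
    constructor <;> funext w <;> refine Prod.ext rfl ?_
    · simp [W0, hatV0, addVertical]
    · simp [W1, hatV1, addVertical]
  ext X
  constructor
  · rintro ⟨A, hA, rfl⟩
    refine ⟨![A 0, A 1, -A 2, -A 3], fun i => ?_, ?_⟩
    · fin_cases i
      exacts [hA 0, hA 1, (hA 2).neg, (hA 3).neg]
    · simp [(hneg _).1, (hneg _).2, (h01 _).1, (h01 _).2]
  · rintro ⟨A, hA, rfl⟩
    refine ⟨![A 0, A 1, -A 2, -A 3], fun i => ?_, ?_⟩
    · fin_cases i
      exacts [hA 0, hA 1, (hA 2).neg, (hA 3).neg]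
    · simp [(hneg _).1, (hneg _).2, (h01 _).1, (h01 _).2]

/-! ### Prolongations in coordinates -/

/-- The coefficients `∂_t^i ∂_z^j ∇^k A` at a point with fibre coordinates `(x, y)`, in terms of
the derivatives `α i j = ∂_t^i ∂_z^j A`. -/
def nbr (x y : ℝ) (α : ℕ → ℕ → ℝ) : ℕ → ℕ → ℕ → ℝ
  | 0, i, j => α i j
  | k + 1, i, j => x * nbr x y α k (i + 1) j + y * nbr x y α k i (j + 1)

theorem nbr_zero (x y : ℝ) (α : ℕ → ℕ → ℝ) (i j : ℕ) : nbr x y α 0 i j = α i j := rfl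

theorem jn_eq_nbr (A : M → ℝ) (k i j : ℕ) (q : TM) :
    jn A k i j q = nbr (q 2) (q 3) (fun i j => jp A i j q) k i j := by
  induction k generalizing i j with
  | zero => rfl
  | succ k ih => simp only [jn, nbr, ih]

section Coefficients

variable (c₁ c₂ c₃ c₄ t z x y : ℝ) (α : Fin 4 → ℕ → ℕ → ℝ)

/-- The derivatives `∂_t^i ∂_z^j` of the components of `fieldH`. -/
def coefV (i j : ℕ) : Fin 4 → ℝ :=
  ![α 0 i (j + 1), -α 0 (i + 1) j, nbr x y (α 0) 1 i (j + 1) + α 1 i (j + 1),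
    -nbr x y (α 0) 1 (i + 1) j - α 1 (i + 1) j]

/-- The derivatives `∂_t^i ∂_z^j ∂_x` of the components of `fieldH`. -/
def coefVx (i j : ℕ) : Fin 4 → ℝ := ![0, 0, α 0 (i + 1) (j + 1), -α 0 (i + 2) j]

/-- The derivatives `∂_t^i ∂_z^j ∂_y` of the components of `fieldH`. -/
def coefVy (i j : ℕ) : Fin 4 → ℝ := ![0, 0, α 0 i (j + 2), -α 0 (i + 1) (j + 1)]

/-- The first derivatives of the components of `fieldH`. -/
def coefDV : Fin 4 → Fin 4 → ℝ := ![coefV x y α 1 0, coefV x y α 0 1, coefVx α 0 0, coefVy α 0 0]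

/-- The second derivatives of the components of `fieldH`. -/
def coefDDV : Fin 4 → Fin 4 → Fin 4 → ℝ :=
  ![![coefV x y α 2 0, coefV x y α 1 1, coefVx α 1 0, coefVy α 1 0],
    ![coefV x y α 1 1, coefV x y α 0 2, coefVx α 0 1, coefVy α 0 1],
    ![coefVx α 1 0, coefVx α 0 1, 0, 0], ![coefVy α 1 0, coefVy α 0 1, 0, 0]]

/-- The derivatives `∂_t^i ∂_z^j` of `vertH`. -/
def coefW (i j : ℕ) : ℝ :=
  c₁ / 6 * nbr x y (α 0) 3 i j +
    c₃ * (t * α 0 (i + 1) j + z * α 0 i (j + 1) + ((i : ℝ) + j - 2) * α 0 i j) +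
    c₁ / 2 * nbr x y (α 1) 2 i j + c₂ * nbr x y (α 1) 1 i j + c₄ * α 1 i j +
    c₁ * nbr x y (α 2) 1 i j + 2 * c₂ * α 2 i j + c₁ * α 3 i j

/-- The derivatives of `vertH` of first order in `x, y` and some order in `t, z`. -/
def coefW1 (i j : ℕ) : ℝ :=
  c₁ / 2 * nbr x y (α 0) 2 i j + c₁ * nbr x y (α 1) 1 i j + c₂ * α 1 i j + c₁ * α 2 i j

/-- The derivatives of `vertH` of second order in `x, y`. -/
def coefW2 (i j : ℕ) : ℝ := c₁ * nbr x y (α 0) 1 i j + c₁ * α 1 i j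

/-- The first derivatives of `vertH`. -/
def coefDW : Fin 4 → ℝ :=
  ![coefW c₁ c₂ c₃ c₄ t z x y α 1 0, coefW c₁ c₂ c₃ c₄ t z x y α 0 1,
    coefW1 c₁ c₂ x y α 1 0, coefW1 c₁ c₂ x y α 0 1]

/-- The second derivatives of `vertH`. -/
def coefDDW : Fin 4 → Fin 4 → ℝ :=
  ![![coefW c₁ c₂ c₃ c₄ t z x y α 2 0, coefW c₁ c₂ c₃ c₄ t z x y α 1 1,
      coefW1 c₁ c₂ x y α 2 0, coefW1 c₁ c₂ x y α 1 1],
    ![coefW c₁ c₂ c₃ c₄ t z x y α 1 1, coefW c₁ c₂ c₃ c₄ t z x y α 0 2,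
      coefW1 c₁ c₂ x y α 1 1, coefW1 c₁ c₂ x y α 0 2],
    ![coefW1 c₁ c₂ x y α 2 0, coefW1 c₁ c₂ x y α 1 1,
      coefW2 c₁ x y α 2 0, coefW2 c₁ x y α 1 1],
    ![coefW1 c₁ c₂ x y α 1 1, coefW1 c₁ c₂ x y α 0 2,
      coefW2 c₁ x y α 1 1, coefW2 c₁ x y α 0 2]]

end Coefficients

/-- The prolongation at `p` of the vector field of `𝔥` whose defining functions have the
derivatives `α m i j = ∂_t^i ∂_z^j A_m` at the point below `p`. -/
def prolH (c₁ c₂ c₃ c₄ : ℝ) (α : Fin 4 → ℕ → ℕ → ℝ) (p : J2) : J2 :=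
  (coefV (p.1 2) (p.1 3) α 0 0, coefW c₁ c₂ c₃ c₄ (p.1 0) (p.1 1) (p.1 2) (p.1 3) α 0 0,
    fun i => coefDW c₁ c₂ c₃ c₄ (p.1 0) (p.1 1) (p.1 2) (p.1 3) α i -
      ∑ k, coefDV (p.1 2) (p.1 3) α i k * p.u1 k,
    symm2 fun i j => coefDDW c₁ c₂ c₃ c₄ (p.1 0) (p.1 1) (p.1 2) (p.1 3) α i j -
      ∑ k, (coefDDV (p.1 2) (p.1 3) α i j k * p.u1 k +
        coefDV (p.1 2) (p.1 3) α i k * p.u2 k j + coefDV (p.1 2) (p.1 3) α j k * p.u2 k i))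

theorem pd_fieldH {A : Fin 4 → M → ℝ} (hA : ∀ i, ContDiff ℝ ∞ (A i)) (i k : Fin 4) :
    pd i (fun q => fieldH A q k) =
      fun q => coefDV (q 2) (q 3) (fun m i j => jp (A m) i j q) i k := by
  have h0 := hA 0
  have h1 := hA 1
  fin_cases i <;> fin_cases k <;>
    simp (disch := fun_prop) [fieldH, coefDV, coefV, coefVx, coefVy, pd_fun_add, pd_fun_sub,
      pd_fun_neg, pd_fun_mul, pd_fun_coord, pd_ct_jp, pd_cz_jp, pd_cx_jp, pd_cy_jp, h0, h1, jn,
      nbr]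

theorem pd_coefDV {A : Fin 4 → M → ℝ} (hA : ∀ i, ContDiff ℝ ∞ (A i)) (i j k : Fin 4) :
    pd j (fun q => coefDV (q 2) (q 3) (fun m i j => jp (A m) i j q) i k) =
      fun q => coefDDV (q 2) (q 3) (fun m i j => jp (A m) i j q) i j k := by
  have h0 := hA 0
  have h1 := hA 1
  fin_cases i <;> fin_cases j <;> fin_cases k <;>
    simp (disch := fun_prop) [coefDV, coefDDV, coefV, coefVx, coefVy, pd_fun_add, pd_fun_sub,
      pd_fun_neg, pd_fun_mul, pd_fun_coord, pd_fun_const, pd_ct_jp, pd_cz_jp, pd_cx_jp, pd_cy_jp,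
      h0, h1, nbr]

theorem pd_vertH (c₁ c₂ c₃ c₄ : ℝ) {A : Fin 4 → M → ℝ} (hA : ∀ i, ContDiff ℝ ∞ (A i))
    (i : Fin 4) : pd i (vertH c₁ c₂ c₃ c₄ A) =
      ![fun q => c₁ / 6 * jn (A 0) 3 1 0 q + c₃ * zj (A 0) 1 0 q + c₁ / 2 * jn (A 1) 2 1 0 q +
          c₂ * jn (A 1) 1 1 0 q + c₄ * jn (A 1) 0 1 0 q + c₁ * jn (A 2) 1 1 0 q +
          2 * c₂ * jn (A 2) 0 1 0 q + c₁ * jn (A 3) 0 1 0 q,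
        fun q => c₁ / 6 * jn (A 0) 3 0 1 q + c₃ * zj (A 0) 0 1 q + c₁ / 2 * jn (A 1) 2 0 1 q +
          c₂ * jn (A 1) 1 0 1 q + c₄ * jn (A 1) 0 0 1 q + c₁ * jn (A 2) 1 0 1 q +
          2 * c₂ * jn (A 2) 0 0 1 q + c₁ * jn (A 3) 0 0 1 q,
        fun q => c₁ / 2 * jn (A 0) 2 1 0 q + c₁ * jn (A 1) 1 1 0 q + c₂ * jn (A 1) 0 1 0 q +
          c₁ * jn (A 2) 0 1 0 q,
        fun q => c₁ / 2 * jn (A 0) 2 0 1 q + c₁ * jn (A 1) 1 0 1 q + c₂ * jn (A 1) 0 0 1 q +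
          c₁ * jn (A 2) 0 0 1 q] i := by
  have h0 := hA 0
  have h1 := hA 1
  have h2 := hA 2
  have h3 := hA 3
  unfold vertH
  fin_cases i <;>
    simp (disch := fun_prop) [pd_fun_add, pd_fun_mul, pd_fun_const, pd_zero_jn, pd_one_jn,
      pd_two_jn_zero, pd_three_jn_zero, pd_two_jn, pd_three_jn, pd_zero_zj, pd_one_zj, pd_two_zj,
      pd_three_zj, h0, h1, h2, h3] <;> funext q <;> ring

theorem pd_vertH_eq (c₁ c₂ c₃ c₄ : ℝ) {A : Fin 4 → M → ℝ} (hA : ∀ i, ContDiff ℝ ∞ (A i))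
    (i : Fin 4) (q : TM) : pd i (vertH c₁ c₂ c₃ c₄ A) q =
      coefDW c₁ c₂ c₃ c₄ (q 0) (q 1) (q 2) (q 3) (fun m i j => jp (A m) i j q) i := by
  rw [pd_vertH _ _ _ _ hA]
  fin_cases i <;> simp [coefDW, coefW, coefW1, jn_eq_nbr, zj, nbr]

theorem pd_pd_vertH (c₁ c₂ c₃ c₄ : ℝ) {A : Fin 4 → M → ℝ} (hA : ∀ i, ContDiff ℝ ∞ (A i))
    (i j : Fin 4) (q : TM) : pd j (pd i (vertH c₁ c₂ c₃ c₄ A)) q =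
      coefDDW c₁ c₂ c₃ c₄ (q 0) (q 1) (q 2) (q 3) (fun m i j => jp (A m) i j q) i j := by
  have h0 := hA 0
  have h1 := hA 1
  have h2 := hA 2
  have h3 := hA 3
  rw [pd_vertH _ _ _ _ hA]
  fin_cases i <;> fin_cases j <;>
    simp (disch := fun_prop) only [Fin.zero_eta, Fin.mk_one, Fin.reduceFinMk, Matrix.cons_val,
      pd_fun_add, pd_fun_mul, pd_fun_const, pd_zero_jn, pd_one_jn, pd_two_jn_zero,
      pd_three_jn_zero, pd_two_jn, pd_three_jn, pd_zero_zj, pd_one_zj, pd_two_zj,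
      pd_three_zj, h0, h1, h2, h3] <;>
    simp [coefDDW, coefW, coefW1, coefW2, jn_eq_nbr, zj, nbr_zero] <;>
    ring

theorem prol_eq_prolH (c₁ c₂ c₃ c₄ : ℝ) {A : Fin 4 → M → ℝ} (hA : ∀ i, ContDiff ℝ ∞ (A i))
    (p : J2) : prol (fieldH A) (vertH c₁ c₂ c₃ c₄ A) p =
      prolH c₁ c₂ c₃ c₄ (fun m i j => jp (A m) i j p.1) p := by
  simp only [prol, prolH, pd_fieldH hA, pd_coefDV hA, pd_vertH_eq _ _ _ _ hA,
    pd_pd_vertH _ _ _ _ hA]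
  refine Prod.ext ?_ (Prod.ext ?_ rfl)
  · funext i
    fin_cases i <;> simp [fieldH, coefV, jn, nbr]
  · simp only [vertH, coefW, jn_eq_nbr, zj, nbr]

/-! ### The differentials of the invariants -/

/-- The base coordinates of a two-jet, as continuous linear maps. -/
def coordBase (i : Fin 4) : J2 →L[ℝ] ℝ :=
  (ContinuousLinearMap.proj (R := ℝ) (φ := fun _ : Fin 4 => ℝ) i) ∘L ContinuousLinearMap.fst ℝ TM _

/-- The first order coordinates of a two-jet, as continuous linear maps. -/
def coord1 (i : Fin 4) : J2 →L[ℝ] ℝ :=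
  (ContinuousLinearMap.proj (R := ℝ) (φ := fun _ : Fin 4 => ℝ) i) ∘L
    ContinuousLinearMap.fst ℝ (Fin 4 → ℝ) _ ∘L ContinuousLinearMap.snd ℝ ℝ _ ∘L
      ContinuousLinearMap.snd ℝ TM _

/-- The second order coordinates of a two-jet, as continuous linear maps. -/
def coord2 (i j : Fin 4) : J2 →L[ℝ] ℝ :=
  (ContinuousLinearMap.proj (R := ℝ) (φ := fun _ : Sym2 (Fin 4) => ℝ) s(i, j)) ∘L
    ContinuousLinearMap.snd ℝ (Fin 4 → ℝ) _ ∘L ContinuousLinearMap.snd ℝ ℝ _ ∘L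
      ContinuousLinearMap.snd ℝ TM _

theorem coordBase_apply (i : Fin 4) (v : J2) : coordBase i v = v.base i := rfl

theorem coord1_apply (i : Fin 4) (v : J2) : coord1 i v = v.u1 i := rfl

theorem coord2_apply (i j : Fin 4) (v : J2) : coord2 i j v = v.u2 i j := rfl

theorem hasFDerivAt_base (p : J2) (i : Fin 4) :
    HasFDerivAt (fun p : J2 => p.base i) (coordBase i) p := (coordBase i).hasFDerivAt

theorem hasFDerivAt_u1 (p : J2) (i : Fin 4) :
    HasFDerivAt (fun p : J2 => p.u1 i) (coord1 i) p := (coord1 i).hasFDerivAt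

theorem hasFDerivAt_u2 (p : J2) (i j : Fin 4) :
    HasFDerivAt (fun p : J2 => p.u2 i j) (coord2 i j) p := (coord2 i j).hasFDerivAt

theorem fderiv_I1 (p v : J2) : fderiv ℝ I1 p v = v.u2 0 3 - v.u2 2 1 + p.u2 2 2 * v.u2 3 3 +
    p.u2 3 3 * v.u2 2 2 - 2 * p.u2 2 3 * v.u2 2 3 := by
  have := (((hasFDerivAt_u2 p 0 3).sub (hasFDerivAt_u2 p 2 1)).add
    ((hasFDerivAt_u2 p 2 2).mul (hasFDerivAt_u2 p 3 3))).sub ((hasFDerivAt_u2 p 2 3).pow 2)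
  have e : fderiv ℝ I1 p = _ := this.fderiv
  rw [e]
  simp [coord2_apply]
  ring

theorem fderiv_I3 (p v : J2) : fderiv ℝ I3 p v = p.u2 2 2 * v.u2 3 3 +
    p.u2 3 3 * v.u2 2 2 - 2 * p.u2 2 3 * v.u2 2 3 := by
  have := ((hasFDerivAt_u2 p 2 2).mul (hasFDerivAt_u2 p 3 3)).sub ((hasFDerivAt_u2 p 2 3).pow 2)
  have e : fderiv ℝ I3 p = _ := this.fderiv
  rw [e]
  simp [coord2_apply]

theorem fderiv_I4 (p v : J2) : fderiv ℝ I4 p v =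
    2 * (p.u1 2 * p.u2 3 3 - p.u1 3 * p.u2 2 3) * v.u1 2 +
    2 * (p.u1 3 * p.u2 2 2 - p.u1 2 * p.u2 2 3) * v.u1 3 + p.u1 3 ^ 2 * v.u2 2 2 -
    2 * p.u1 2 * p.u1 3 * v.u2 2 3 + p.u1 2 ^ 2 * v.u2 3 3 := by
  have := ((((hasFDerivAt_u1 p 3).pow 2).mul (hasFDerivAt_u2 p 2 2)).sub
    ((((hasFDerivAt_u1 p 2).const_mul 2).mul (hasFDerivAt_u1 p 3)).mul
      (hasFDerivAt_u2 p 2 3))).add (((hasFDerivAt_u1 p 2).pow 2).mul (hasFDerivAt_u2 p 3 3))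
  have e : fderiv ℝ I4 p = _ := this.fderiv
  rw [e]
  simp [coord1_apply, coord2_apply]
  ring

theorem fderiv_I2 (p v : J2) : fderiv ℝ I2 p v =
    2 * ((p.u1 2 + p.base 3) * p.u2 3 3 - (p.u1 3 - p.base 2) * p.u2 2 3) * (v.u1 2 + v.base 3) +
    2 * ((p.u1 3 - p.base 2) * p.u2 2 2 - (p.u1 2 + p.base 3) * p.u2 2 3) * (v.u1 3 - v.base 2) +
    (p.u1 3 - p.base 2) ^ 2 * v.u2 2 2 -
    2 * (p.u1 2 + p.base 3) * (p.u1 3 - p.base 2) * v.u2 2 3 +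
    (p.u1 2 + p.base 3) ^ 2 * v.u2 3 3 := by
  have ha := (hasFDerivAt_u1 p 2).add (hasFDerivAt_base p 3)
  have hb := (hasFDerivAt_u1 p 3).sub (hasFDerivAt_base p 2)
  have := (((hb.pow 2).mul (hasFDerivAt_u2 p 2 2)).sub
    (((ha.const_mul 2).mul hb).mul (hasFDerivAt_u2 p 2 3))).add
      ((ha.pow 2).mul (hasFDerivAt_u2 p 3 3))
  have e : fderiv ℝ I2 p = _ := this.fderiv
  rw [e]
  simp [coordBase_apply, coord1_apply, coord2_apply]
  ring

theorem contDiff_I1 {n : WithTop ℕ∞} : ContDiff ℝ n I1 := by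
  unfold I1 J2.u2; fun_prop

theorem contDiff_I2 {n : WithTop ℕ∞} : ContDiff ℝ n I2 := by
  unfold I2 J2.u2 J2.u1 J2.base; fun_prop

theorem contDiff_I3 {n : WithTop ℕ∞} : ContDiff ℝ n I3 := by
  unfold I3 J2.u2; fun_prop

theorem contDiff_I4 {n : WithTop ℕ∞} : ContDiff ℝ n I4 := by
  unfold I4 J2.u2 J2.u1; fun_prop

/-! ### Invariance of the listed functions -/

section Invariance

variable (α : Fin 4 → ℕ → ℕ → ℝ) (p : J2)

theorem u2_comm (p : J2) (i j : Fin 4) : p.u2 i j = p.u2 j i := by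
  simp only [J2.u2, Sym2.eq_swap]

theorem prolH_base (c₁ c₂ c₃ c₄ : ℝ) (i : Fin 4) :
    (prolH c₁ c₂ c₃ c₄ α p).base i = coefV (p.1 2) (p.1 3) α 0 0 i := rfl

theorem prolH_u1 (c₁ c₂ c₃ c₄ : ℝ) (i : Fin 4) : (prolH c₁ c₂ c₃ c₄ α p).u1 i =
    coefDW c₁ c₂ c₃ c₄ (p.1 0) (p.1 1) (p.1 2) (p.1 3) α i -
      ∑ k, coefDV (p.1 2) (p.1 3) α i k * p.u1 k := rfl

theorem prolH_u2 (c₁ c₂ c₃ c₄ : ℝ) (i j : Fin 4) : (prolH c₁ c₂ c₃ c₄ α p).u2 i j =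
    coefDDW c₁ c₂ c₃ c₄ (p.1 0) (p.1 1) (p.1 2) (p.1 3) α i j -
      ∑ k, (coefDDV (p.1 2) (p.1 3) α i j k * p.u1 k +
        coefDV (p.1 2) (p.1 3) α i k * p.u2 k j + coefDV (p.1 2) (p.1 3) α j k * p.u2 k i) := by
  have h1 : ∀ i j, coefDDW c₁ c₂ c₃ c₄ (p.1 0) (p.1 1) (p.1 2) (p.1 3) α i j =
      coefDDW c₁ c₂ c₃ c₄ (p.1 0) (p.1 1) (p.1 2) (p.1 3) α j i := fun i j => by
    fin_cases i <;> fin_cases j <;> rfl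
  have h2 : ∀ i j, coefDDV (p.1 2) (p.1 3) α i j = coefDDV (p.1 2) (p.1 3) α j i := fun i j => by
    fin_cases i <;> fin_cases j <;> rfl
  simp only [J2.u2, prolH, symm2_mk]
  rw [h1 j i, h2 j i]
  simp only [Fin.sum_univ_four]
  ring

theorem fderiv_I1_prolH : fderiv ℝ I1 p (prolH (-1) 0 0 0 α p) = 0 := by
  rw [fderiv_I1]
  simp only [prolH_u2, Fin.sum_univ_four]
  simp [coefDDW, coefDDV, coefDV, coefV, coefVx, coefVy, coefW1, coefW2, nbr]
  simp only [u2_comm p 2 0, u2_comm p 3 0, u2_comm p 2 1, u2_comm p 3 1,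
    u2_comm p 3 2]
  ring

theorem fderiv_I2_prolH : fderiv ℝ I2 p (prolH 0 1 0 0 α p) = 0 := by
  rw [fderiv_I2]
  simp only [prolH_base, prolH_u1, prolH_u2, Fin.sum_univ_four]
  simp [coefDW, coefDDW, coefDDV, coefDV, coefV, coefVx, coefVy, coefW1, coefW2, nbr]
  simp only [u2_comm p 3 2, J2.base]
  ring

theorem fderiv_I3_prolH (c₂ c₃ c₄ : ℝ) : fderiv ℝ I3 p (prolH 0 c₂ c₃ c₄ α p) = 0 := by
  rw [fderiv_I3]
  simp only [prolH_u2, Fin.sum_univ_four]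
  simp [coefDDW, coefDDV, coefDV, coefV, coefVx, coefVy, coefW2]
  simp only [u2_comm p 3 2]
  ring

theorem fderiv_I4_prolH (c₃ c₄ : ℝ) : fderiv ℝ I4 p (prolH 0 0 c₃ c₄ α p) = 0 := by
  rw [fderiv_I4]
  simp only [prolH_u1, prolH_u2, Fin.sum_univ_four]
  simp [coefDW, coefDDW, coefDDV, coefDV, coefV, coefVx, coefVy, coefW1, coefW2]
  simp only [u2_comm p 3 2]
  ring

end Invariance

theorem isInvariant_h {c₁ c₂ c₃ c₄ : ℝ} {I : J2 → ℝ} (hI : ContDiff ℝ ∞ I)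
    (h0 : ∀ α p, fderiv ℝ I p (prolH c₁ c₂ c₃ c₄ α p) = 0) :
    IsInvariant (pseudogroup (h c₁ c₂ c₃ c₄)) I := by
  refine isInvariant_pseudogroup (hI.differentiable (by simp)) (fun X hX r => smul_mem_h hX r)
    fun X hX => ?_
  obtain ⟨A, hA, rfl⟩ := mem_h_iff.1 hX
  exact ⟨_, _, contDiff_fieldH hA, contDiff_vertH c₁ c₂ c₃ c₄ hA, rfl, fun p => by
    rw [prol_eq_prolH _ _ _ _ hA, h0]⟩

/-! ### Ridge functions -/

/-- The function `P(a t + b z)` on the surface. -/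
def ridge (a b : ℝ) (P : Polynomial ℝ) : M → ℝ := fun m => P.eval (a * m 0 + b * m 1)

theorem contDiff_ridge (a b : ℝ) (P : Polynomial ℝ) : ContDiff ℝ ∞ (ridge a b P) :=
  (show ContDiff ℝ ∞ fun x => P.eval x by
    simpa only [Polynomial.coe_aeval_eq_eval] using! P.contDiff_aeval ∞).comp
      (by fun_prop : ContDiff ℝ ∞ fun m : M => a * m 0 + b * m 1)

theorem pd_ridge (a b : ℝ) (P : Polynomial ℝ) (i : Fin 2) :
    pd i (ridge a b P) = ridge a b (Polynomial.C (![a, b] i) * P.derivative) := by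
  funext m
  have h1 : HasFDerivAt (fun m : M => a * m 0 + b * m 1)
      (a • (ContinuousLinearMap.proj (R := ℝ) (φ := fun _ : Fin 2 => ℝ) 0) +
        b • (ContinuousLinearMap.proj (R := ℝ) (φ := fun _ : Fin 2 => ℝ) 1)) m :=
    ((hasFDerivAt_apply 0 m).const_mul a).add ((hasFDerivAt_apply 1 m).const_mul b)
  have h2 := ((P.hasDerivAt (a * m 0 + b * m 1)).comp_hasFDerivAt m h1).fderiv
  have h3 : ridge a b P = (fun x => P.eval x) ∘ fun m : M => a * m 0 + b * m 1 := rfl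
  rw [pd, h3, h2]
  fin_cases i <;> simp [ridge, mul_comm]

theorem pd_iterate_ridge (a b : ℝ) (P : Polynomial ℝ) (i : Fin 2) (n : ℕ) :
    (pd i)^[n] (ridge a b P) =
      ridge a b (Polynomial.C (![a, b] i ^ n) * Polynomial.derivative^[n] P) := by
  induction n with
  | zero => simp
  | succ n ih =>
    rw [Function.iterate_succ_apply', ih, pd_ridge, Function.iterate_succ_apply']
    rw [Polynomial.derivative_C_mul, pow_succ, Polynomial.C_mul]
    congr 1
    ring

theorem jp_ridge (a b : ℝ) (P : Polynomial ℝ) (i j : ℕ) (q : TM) :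
    jp (ridge a b P) i j q =
      a ^ i * b ^ j * (Polynomial.derivative^[i + j] P).eval (a * q 0 + b * q 1) := by
  rw [jp, pd_iterate_ridge, pd_iterate_ridge, Polynomial.iterate_derivative_C_mul,
    ← Function.iterate_add_apply]
  simp [pull, ridge, add_comm i j]
  ring

theorem jn_ridge (a b : ℝ) (P : Polynomial ℝ) (k i j : ℕ) (q : TM) :
    jn (ridge a b P) k i j q = a ^ i * b ^ j * (a * q 2 + b * q 3) ^ k *
      (Polynomial.derivative^[i + j + k] P).eval (a * q 0 + b * q 1) := by
  induction k generalizing i j with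
  | zero => simp [jn, jp_ridge]
  | succ k ih =>
    simp only [jn, ih]
    rw [show i + 1 + j + k = i + j + (k + 1) by ring,
      show i + (j + 1) + k = i + j + (k + 1) by ring]
    ring

/-- The vector fields of `𝔥` defined by ridge functions in a common direction are straight. -/
theorem isStraight_ridge (c₁ c₂ c₃ c₄ a b : ℝ) (P : Fin 4 → Polynomial ℝ) :
    IsStraight (fieldH fun m => ridge a b (P m)) (vertH c₁ c₂ c₃ c₄ fun m => ridge a b (P m)) := by
  have hA : ∀ m, ContDiff ℝ ∞ (ridge a b (P m)) := fun m => contDiff_ridge a b (P m)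
  have e1 : ∀ q (s : ℝ), a * (q + s • fieldH (fun m => ridge a b (P m)) q) 0 +
      b * (q + s • fieldH (fun m => ridge a b (P m)) q) 1 = a * q 0 + b * q 1 := fun q s => by
    simp [fieldH, jn_ridge]
    ring
  have e2 : ∀ q (s : ℝ), a * (q + s • fieldH (fun m => ridge a b (P m)) q) 2 +
      b * (q + s • fieldH (fun m => ridge a b (P m)) q) 3 = a * q 2 + b * q 3 := fun q s => by
    simp [fieldH, jn_ridge]
    ring
  have e3 : ∀ m k i j q (s : ℝ), jn (ridge a b (P m)) k i j
      (q + s • fieldH (fun m => ridge a b (P m)) q) = jn (ridge a b (P m)) k i j q :=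
    fun m k i j q s => by rw [jn_ridge, e1, e2, jn_ridge]
  have e4 : ∀ q, zj (ridge a b (P 0)) 0 0 q = (a * q 0 + b * q 1) *
      (Polynomial.derivative (P 0)).eval (a * q 0 + b * q 1) -
        2 * (P 0).eval (a * q 0 + b * q 1) := fun q => by
    simp [zj, jp_ridge]
    ring
  refine ⟨contDiff_fieldH hA, contDiff_vertH _ _ _ _ hA, fun q s => ?_, fun q s => ?_⟩
  · rw [fieldH]
    simp only [e3]
    rfl
  · simp only [vertH, e3, e4, e1]

/-- The derivatives at a point of a ridge function that is a power of a linear form vanishing at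
that point, inserted at the position `m`. -/
def monoJet (m : Fin 4) (k : ℕ) (a b : ℝ) : Fin 4 → ℕ → ℕ → ℝ := fun m' i j =>
  if m' = m ∧ i + j = k then a ^ i * b ^ j else 0

/-- Every local invariant of `𝔥` is annihilated by the prolongations of ridge fields. -/
theorem fderiv_prolH_monoJet {c₁ c₂ c₃ c₄ : ℝ} {U : Set J2} {F : J2 → ℝ} (hU : IsOpen U)
    (hF : ContDiffOn ℝ ∞ F U) (hinv : IsLocalInvariantOn (h c₁ c₂ c₃ c₄) U F) {p : J2}
    (hp : p ∈ U) (m : Fin 4) (k : ℕ) (a b : ℝ) :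
    fderiv ℝ F p (prolH c₁ c₂ c₃ c₄ (monoJet m k a b) p) = 0 := by
  let P : Fin 4 → Polynomial ℝ := fun m' => if m' = m then
    Polynomial.C ((k.factorial : ℝ)⁻¹) * (Polynomial.X - Polynomial.C (a * p.1 0 + b * p.1 1)) ^ k
    else 0
  have hA : ∀ m, ContDiff ℝ ∞ (ridge a b (P m)) := fun m => contDiff_ridge a b (P m)
  have hz := fderiv_prol_eq_zero hU hF hinv (isStraight_ridge c₁ c₂ c₃ c₄ a b P)
    (fun ε => smul_mem_h (mem_h_iff.2 ⟨_, hA, rfl⟩) ε) hp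
  rw [prol_eq_prolH _ _ _ _ hA] at hz
  convert hz using 3
  funext m' i j
  rw [jp_ridge, monoJet]
  by_cases hm : m' = m
  · simp only [hm, true_and, P, if_true, Polynomial.iterate_derivative_C_mul,
      Polynomial.iterate_derivative_X_sub_pow]
    rcases lt_trichotomy (i + j) k with hlt | heq | hgt
    · rw [if_neg hlt.ne]
      simp [Nat.sub_ne_zero_of_lt hlt]
    · rw [if_pos heq, heq]
      simp [Nat.descFactorial_self, Nat.factorial_ne_zero]
    · rw [if_neg hgt.ne']
      simp [Nat.descFactorial_of_lt hgt]
  · simp [hm, P]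

/-! ### Covectors on the space of two-jets -/

theorem map_eq_sum_single {ι : Type*} [Fintype ι] [DecidableEq ι] (f : (ι → ℝ) →ₗ[ℝ] ℝ)
    (w : ι → ℝ) : f w = ∑ i, f (Pi.single i 1) * w i := by
  conv_lhs => rw [pi_eq_sum_univ' w, map_sum]
  exact Finset.sum_congr rfl fun k _ => by rw [map_smul, smul_eq_mul, mul_comm]

theorem sum_sym2_four (f : Sym2 (Fin 4) → ℝ) : ∑ z, f z =
    f s(0, 0) + f s(0, 1) + f s(0, 2) + f s(0, 3) + f s(1, 1) + f s(1, 2) + f s(1, 3) +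
      f s(2, 2) + f s(2, 3) + f s(3, 3) := by
  have : (Finset.univ : Finset (Sym2 (Fin 4))) = {s(0, 0), s(0, 1), s(0, 2), s(0, 3), s(1, 1),
    s(1, 2), s(1, 3), s(2, 2), s(2, 3), s(3, 3)} := by decide
  rw [this]
  repeat rw [Finset.sum_insert (by decide)]
  rw [Finset.sum_singleton]
  ring

/-- A covector on the space of two-jets in coordinates. -/
theorem exists_coefficients (L : J2 →L[ℝ] ℝ) :
    ∃ (a : Fin 4 → ℝ) (e : ℝ) (b : Fin 4 → ℝ) (c : Fin 4 → Fin 4 → ℝ), ∀ v : J2, L v =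
      a 0 * v.base 0 + a 1 * v.base 1 + a 2 * v.base 2 + a 3 * v.base 3 + e * v.2.1 +
      (b 0 * v.u1 0 + b 1 * v.u1 1 + b 2 * v.u1 2 + b 3 * v.u1 3) +
      (c 0 0 * v.u2 0 0 + c 0 1 * v.u2 0 1 + c 0 2 * v.u2 0 2 + c 0 3 * v.u2 0 3 +
        c 1 1 * v.u2 1 1 + c 1 2 * v.u2 1 2 + c 1 3 * v.u2 1 3 + c 2 2 * v.u2 2 2 +
        c 2 3 * v.u2 2 3 + c 3 3 * v.u2 3 3) := by
  let l : J2 →ₗ[ℝ] ℝ := L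
  let l0 : TM →ₗ[ℝ] ℝ := l ∘ₗ LinearMap.inl ℝ _ _
  let l1 : ℝ →ₗ[ℝ] ℝ := l ∘ₗ LinearMap.inr ℝ _ _ ∘ₗ LinearMap.inl ℝ _ _
  let l2 : (Fin 4 → ℝ) →ₗ[ℝ] ℝ :=
    l ∘ₗ LinearMap.inr ℝ _ _ ∘ₗ LinearMap.inr ℝ _ _ ∘ₗ LinearMap.inl ℝ _ _
  let l3 : (Sym2 (Fin 4) → ℝ) →ₗ[ℝ] ℝ :=
    l ∘ₗ LinearMap.inr ℝ _ _ ∘ₗ LinearMap.inr ℝ _ _ ∘ₗ LinearMap.inr ℝ _ _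
  refine ⟨fun i => l0 (Pi.single i 1), l1 1, fun i => l2 (Pi.single i 1),
    fun i j => l3 (Pi.single s(i, j) 1), fun v => ?_⟩
  have hv : L v = l0 v.1 + l1 v.2.1 + l2 v.2.2.1 + l3 v.2.2.2 := by
    change l v = l _ + l _ + l _ + l _
    rw [← map_add, ← map_add, ← map_add]
    congr 1
    simp
  have h1 : l1 v.2.1 = l1 1 * v.2.1 := by
    conv_lhs => rw [← mul_one v.2.1, ← smul_eq_mul, map_smul, smul_eq_mul, mul_comm]
  rw [hv, map_eq_sum_single l0, h1, map_eq_sum_single l2, map_eq_sum_single l3, sum_sym2_four,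
    Fin.sum_univ_four, Fin.sum_univ_four]
  rfl

/-- The orbit equations of `𝔰𝔩₂` acting on a vector and a quadratic form. -/
theorem exists_combination {A B h11 h12 h22 Fa Fb X Y Z : ℝ}
    (s1 : B * Fa + 2 * h12 * X + h22 * Y = 0) (s2 : A * Fb + 2 * h12 * Z + h11 * Y = 0)
    (s3 : A * Fa - B * Fb + 2 * h11 * X - 2 * h22 * Z = 0) (hB : B ≠ 0)
    (hd : B * h11 - A * h12 ≠ 0) :
    ∃ r s : ℝ, Fa = s * (2 * (A * h22 - B * h12)) ∧ Fb = s * (2 * (B * h11 - A * h12)) ∧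
      X = r * h22 + s * B ^ 2 ∧ Y = -(2 * r * h12) - 2 * s * A * B ∧ Z = r * h11 + s * A ^ 2 := by
  refine ⟨(A * Y + 2 * B * Z) / (2 * (B * h11 - A * h12)), Fb / (2 * (B * h11 - A * h12)),
    ?_, ?_, ?_, ?_, ?_⟩
  · have h : B * ((B * h11 - A * h12) * Fa) = B * (Fb * (A * h22 - B * h12)) := by
      linear_combination (B * h11 - A * h12) * s1 - h12 * (B * s3 - A * s1) - B * h22 * s2
    have := mul_left_cancel₀ hB h
    field_simp
    linear_combination this
  · field_simp
  · field_simp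
    linear_combination B * s3 - A * s1
  · field_simp
    linear_combination B * s2
  · field_simp
    linear_combination -A * s2

theorem span_I1 {L : J2 →L[ℝ] ℝ} {p : J2}
    (hL : ∀ m k a b, L (prolH (-1) 0 0 0 (monoJet m k a b) p) = 0) :
    ∃ r : ℝ, L = r • fderiv ℝ I1 p := by
  obtain ⟨a, e, b, c, hc⟩ := exists_coefficients L
  simp only [hc, prolH_base, prolH_u1, prolH_u2, Fin.sum_univ_four, u2_comm p 1 0, u2_comm p 2 0,
    u2_comm p 3 0, u2_comm p 2 1, u2_comm p 3 1, u2_comm p 3 2] at hL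
  simp [prolH, coefDW, coefDDW, coefDDV, coefDV, coefV, coefVx, coefVy, coefW, coefW1, coefW2,
    nbr] at hL
  have e3010 := hL 3 0 1 0
  simp [monoJet] at e3010
  have e3110 := hL 3 1 1 0
  simp [monoJet, e3010] at e3110
  have e3101 := hL 3 1 0 1
  simp [monoJet, e3010, e3110] at e3101
  have e3210 := hL 3 2 1 0
  simp [monoJet, e3010, e3110, e3101] at e3210
  have e3201 := hL 3 2 0 1
  simp [monoJet, e3010, e3110, e3101, e3210] at e3201
  have e3211 := hL 3 2 1 1
  simp [monoJet, e3010, e3110, e3101, e3210, e3201] at e3211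
  have e2110 := hL 2 1 1 0
  simp [monoJet, e3010, e3110, e3101, e3210, e3201, e3211] at e2110
  have e2101 := hL 2 1 0 1
  simp [monoJet, e3010, e3110, e3101, e3210, e3201, e3211, e2110] at e2101
  have e2210 := hL 2 2 1 0
  simp [monoJet, e3010, e3110, e3101, e3210, e3201, e3211, e2110, e2101] at e2210
  have e2201 := hL 2 2 0 1
  simp [monoJet, e3010, e3110, e3101, e3210, e3201, e3211, e2110, e2101, e2210] at e2201
  have e2211 := hL 2 2 1 1
  simp [monoJet, e3010, e3110, e3101, e3210, e3201, e3211, e2110, e2101, e2210, e2201] at e2211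
  have e1110 := hL 1 1 1 0
  simp [monoJet, e3010, e3110, e3101, e3210, e3201, e3211, e2110, e2101, e2210, e2201] at e1110
  have e1101 := hL 1 1 0 1
  simp [monoJet, e3010, e3110, e3101, e3210, e3201, e3211, e2110, e2101, e2210, e2201,
    e1110] at e1101
  have e1210 := hL 1 2 1 0
  simp [monoJet, e3010, e3110, e3101, e3210, e3201, e3211, e2110, e2101, e2210, e2201, e1110,
    e1101] at e1210
  have e1201 := hL 1 2 0 1
  simp [monoJet, e3010, e3110, e3101, e3210, e3201, e3211, e2110, e2101, e2210, e2201, e1110,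
    e1101] at e1201
  have e1211 := hL 1 2 1 1
  simp [monoJet, e3010, e3110, e3101, e3210, e3201, e3211, e2110, e2101, e2210, e2201, e1110,
    e1101] at e1211
  have e0110 := hL 0 1 1 0
  simp [monoJet, e3010, e3110, e3101, e3210, e3201, e3211, e2110, e2101, e2210, e2201, e1110,
    e1101] at e0110
  have e0101 := hL 0 1 0 1
  simp [monoJet, e3010, e3110, e3101, e3210, e3201, e3211, e2110, e2101, e2210, e2201, e1110,
    e1101, e0110] at e0101
  clear hL
  refine ⟨c 0 3, ContinuousLinearMap.ext fun v => ?_⟩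
  have h12 : c 1 2 = -c 0 3 := by linarith
  have h22 : c 2 2 = c 0 3 * p.u2 3 3 := by linarith
  have h33 : c 3 3 = c 0 3 * p.u2 2 2 := by rw [h12] at e1201; linarith
  have h23 : c 2 3 = -(2 * c 0 3 * p.u2 2 3) := by
    rw [h12] at e1211 e1201
    linear_combination -e1211 + e1210 + e1201
  rw [smul_apply, hc, fderiv_I1, u2_comm v 2 1, h12, h22, h33, h23, e3010, e3110, e3101, e3210,
    e3201, e3211, e2110, e2101, e2210, e2201, e1110, e1101, e0110, e0101, smul_eq_mul]
  ring

theorem span_I2_I3 {L : J2 →L[ℝ] ℝ} {p : J2} (hA : p.u1 2 + p.base 3 ≠ 0)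
    (hB : p.u1 3 - p.base 2 ≠ 0)
    (hd : (p.u1 3 - p.base 2) * p.u2 2 2 - (p.u1 2 + p.base 3) * p.u2 2 3 ≠ 0)
    (hL : ∀ m k a b, L (prolH 0 1 0 0 (monoJet m k a b) p) = 0) :
    ∃ r s : ℝ, L = r • fderiv ℝ I2 p + s • fderiv ℝ I3 p := by
  obtain ⟨a, e, b, c, hc⟩ := exists_coefficients L
  simp only [hc, prolH_base, prolH_u1, prolH_u2, Fin.sum_univ_four, u2_comm p 1 0, u2_comm p 2 0,
    u2_comm p 3 0, u2_comm p 2 1, u2_comm p 3 1, u2_comm p 3 2] at hL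
  simp [prolH, coefDW, coefDDW, coefDDV, coefDV, coefV, coefVx, coefVy, coefW, coefW1, coefW2,
    nbr] at hL
  have e2010 := hL 2 0 1 0
  simp [monoJet] at e2010
  have e2110 := hL 2 1 1 0
  simp [monoJet, e2010] at e2110
  have e2101 := hL 2 1 0 1
  simp [monoJet, e2010, e2110] at e2101
  have e2210 := hL 2 2 1 0
  simp [monoJet, e2010, e2110, e2101] at e2210
  have e2201 := hL 2 2 0 1
  simp [monoJet, e2010, e2110, e2101, e2210] at e2201
  have e2211 := hL 2 2 1 1
  simp [monoJet, e2010, e2110, e2101, e2210, e2201] at e2211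
  have e0110 := hL 0 1 1 0
  simp [monoJet, e2010, e2110, e2101, e2210, e2201, e2211] at e0110
  have e0101 := hL 0 1 0 1
  simp [monoJet, e2010, e2110, e2101, e2210, e2201, e2211, e0110] at e0101
  have e1110 := hL 1 1 1 0
  simp [monoJet, e2010, e2110, e2101, e2210, e2201, e2211, e0110, e0101] at e1110
  have e1101 := hL 1 1 0 1
  simp [monoJet, e2010, e2110, e2101, e2210, e2201, e2211, e0110, e0101] at e1101
  have e1210 := hL 1 2 1 0
  simp [monoJet, e2010, e2110, e2101, e2210, e2201, e2211, e0110, e0101] at e1210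
  have e1201 := hL 1 2 0 1
  simp [monoJet, e2010, e2110, e2101, e2210, e2201, e2211, e0110, e0101] at e1201
  have e1211 := hL 1 2 1 1
  simp [monoJet, e2010, e2110, e2101, e2210, e2201, e2211, e0110, e0101] at e1211
  have e0210 := hL 0 2 1 0
  simp [monoJet, e2010, e2110, e2101, e2210, e2201, e2211, e0110, e0101] at e0210
  have e0201 := hL 0 2 0 1
  simp [monoJet, e2010, e2110, e2101, e2210, e2201, e2211, e0110, e0101] at e0201
  have e0211 := hL 0 2 1 1
  simp [monoJet, e2010, e2110, e2101, e2210, e2201, e2211, e0110, e0101] at e0211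
  have e0310 := hL 0 3 1 0
  simp [monoJet, e2010, e2110, e2101, e2210, e2201, e2211, e0110, e0101] at e0310
  have e0301 := hL 0 3 0 1
  simp [monoJet, e2010, e2110, e2101, e2210, e2201, e2211, e0110, e0101] at e0301
  have e0311 := hL 0 3 1 1
  simp [monoJet, e2010, e2110, e2101, e2210, e2201, e2211, e0110, e0101] at e0311
  have e031n1 := hL 0 3 1 (-1)
  simp [monoJet, e2010, e2110, e2101, e2210, e2201, e2211, e0110, e0101] at e031n1
  clear hL
  have hc02 : c 0 2 = 0 := (mul_eq_zero.1 (show c 0 2 * (p.u1 3 - p.base 2) = 0 by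
    rw [J2.base]; linear_combination e0310 - p.1 2 * e1210)).resolve_right hB
  have hc13 : c 1 3 = 0 := (mul_eq_zero.1 (show c 1 3 * (p.u1 2 + p.base 3) = 0 by
    rw [J2.base]; linear_combination -e0301 + p.1 3 * e1201)).resolve_right hA
  simp only [hc02, hc13, zero_mul, zero_add, add_zero] at e1210 e1201 e1211 e0311 e031n1
  have hc12 : c 0 3 + c 1 2 = 0 :=
    (mul_eq_zero.1 (show (c 0 3 + c 1 2) * (p.u1 2 + p.base 3) = 0 by
      rw [J2.base]
      linear_combination -1 / 2 * (e031n1 - (p.1 2 - p.1 3) * (2 * e1210 + 2 * e1201 - e1211)) -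
        1 / 2 * (e0311 - (p.1 2 + p.1 3) * e1211))).resolve_right hA
  have hc03 : c 0 3 = 0 := by
    have h1 : c 0 3 * p.u2 2 2 = 0 := by linear_combination e1201 + p.u2 2 2 * hc12
    have h2 : c 0 3 * p.u2 2 3 = 0 := by
      linear_combination 1 / 2 * (-e1211 + e1210 + h1 + (1 - p.u2 2 2 + p.u2 2 3) * hc12)
    refine (mul_eq_zero.1 (?_ : c 0 3 *
      ((p.u1 3 - p.base 2) * p.u2 2 2 - (p.u1 2 + p.base 3) * p.u2 2 3) = 0)).resolve_right hd
    linear_combination (p.u1 3 - p.base 2) * h1 - (p.u1 2 + p.base 3) * h2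
  have hc12' : c 1 2 = 0 := by linarith
  have ha3 : a 3 = b 2 := by linarith
  have ha2 : a 2 = -b 3 := by linarith
  simp only [hc02, hc13, hc03, hc12', ha2, ha3, zero_mul, zero_add, add_zero, neg_zero]
    at e0210 e0201 e0211
  obtain ⟨r, s, h1, h2, h3, h4, h5⟩ := exists_combination (A := p.u1 2 + p.base 3)
    (B := p.u1 3 - p.base 2) (h11 := p.u2 2 2) (h12 := p.u2 2 3) (h22 := p.u2 3 3) (Fa := b 2)
    (Fb := b 3) (X := c 2 2) (Y := c 2 3) (Z := c 3 3)
    (by rw [J2.base]; linear_combination e0210)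
    (by rw [J2.base]; linear_combination -e0201)
    (by simp only [J2.base]; linear_combination e0210 + e0201 - e0211) hB hd
  refine ⟨s, r, ContinuousLinearMap.ext fun v => ?_⟩
  rw [add_apply, smul_apply, smul_apply, hc, fderiv_I2, fderiv_I3, hc02, hc13, hc03, hc12', ha2,
    ha3, h1, h2, h3, h4, h5, e2010, e2110, e2101, e2210, e2201, e2211, e0110, e0101, smul_eq_mul,
    smul_eq_mul]
  ring

theorem span_I3_I4 {c₃ c₄ : ℝ} (hcc : (c₃, c₄) ≠ (0, 0)) {L : J2 →L[ℝ] ℝ} {p : J2}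
    (hA : p.u1 2 ≠ 0) (hB : p.u1 3 ≠ 0) (hd : p.u1 3 * p.u2 2 2 - p.u1 2 * p.u2 2 3 ≠ 0)
    (hI : I4 p ≠ 0)
    (hL : ∀ m k a b, L (prolH 0 0 c₃ c₄ (monoJet m k a b) p) = 0) :
    ∃ r s : ℝ, L = r • fderiv ℝ I3 p + s • fderiv ℝ I4 p := by
  obtain ⟨a, e, b, c, hc⟩ := exists_coefficients L
  simp only [hc, prolH_base, prolH_u1, prolH_u2, Fin.sum_univ_four, u2_comm p 1 0, u2_comm p 2 0,
    u2_comm p 3 0, u2_comm p 2 1, u2_comm p 3 1, u2_comm p 3 2] at hL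
  simp [prolH, coefDW, coefDDW, coefDDV, coefDV, coefV, coefVx, coefVy, coefW, coefW1, coefW2,
    nbr] at hL
  have he : e = 0 := by
    by_contra he
    have e10 := hL 1 0 1 0
    have e00 := hL 0 0 1 0
    simp [monoJet, he] at e10 e00
    exact hcc (Prod.ext e00 e10)
  have e1310 := hL 1 3 1 0
  simp [monoJet, hA, hB] at e1310
  have e1301 := hL 1 3 0 1
  simp [monoJet, hA, hB] at e1301
  have e1311 := hL 1 3 1 1
  simp [monoJet, e1310, e1301] at e1311
  have e131n1 := hL 1 3 1 (-1)
  simp [monoJet, e1310, e1301] at e131n1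
  have hc01 : c 0 1 = 0 := by
    by_contra h
    exact hB (by linarith [e1311.resolve_left h, e131n1.resolve_left h])
  have e1110 := hL 1 1 1 0
  simp [monoJet, he, hc01, e1310, e1301] at e1110
  have e1101 := hL 1 1 0 1
  simp [monoJet, he, hc01, e1310, e1301] at e1101
  have e1210 := hL 1 2 1 0
  simp [monoJet, he, hc01, e1310, e1301] at e1210
  have e1201 := hL 1 2 0 1
  simp [monoJet, he, hc01, e1310, e1301] at e1201
  have e1211 := hL 1 2 1 1
  simp [monoJet, he, hc01, e1310, e1301] at e1211
  have e0110 := hL 0 1 1 0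
  simp [monoJet, he, hc01, e1310, e1301] at e0110
  have e0101 := hL 0 1 0 1
  simp [monoJet, he, hc01, e1310, e1301] at e0101
  have e0210 := hL 0 2 1 0
  simp [monoJet, he, hc01, e1310, e1301] at e0210
  have e0201 := hL 0 2 0 1
  simp [monoJet, he, hc01, e1310, e1301] at e0201
  have e0211 := hL 0 2 1 1
  simp [monoJet, he, hc01, e1310, e1301] at e0211
  have e0310 := hL 0 3 1 0
  simp [monoJet, he, hc01, e1310, e1301] at e0310
  have e0301 := hL 0 3 0 1
  simp [monoJet, he, hc01, e1310, e1301] at e0301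
  have e0311 := hL 0 3 1 1
  simp [monoJet, he, hc01, e1310, e1301] at e0311
  have e031n1 := hL 0 3 1 (-1)
  simp [monoJet, he, hc01, e1310, e1301] at e031n1
  clear hL
  have hc02 : c 0 2 = 0 := (mul_eq_zero.1 (show c 0 2 * p.u1 3 = 0 by
    linear_combination e0310 - p.1 2 * e1210)).resolve_right hB
  have hc13 : c 1 3 = 0 := (mul_eq_zero.1 (show c 1 3 * p.u1 2 = 0 by
    linear_combination -e0301 + p.1 3 * e1201)).resolve_right hA
  simp only [hc02, hc13, zero_mul, zero_add, add_zero] at e1210 e1201 e1211 e0311 e031n1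
  have hc12 : c 0 3 + c 1 2 = 0 :=
    (mul_eq_zero.1 (show (c 0 3 + c 1 2) * p.u1 2 = 0 by
      linear_combination -1 / 2 * (e031n1 - (p.1 2 - p.1 3) * (2 * e1210 + 2 * e1201 - e1211)) -
        1 / 2 * (e0311 - (p.1 2 + p.1 3) * e1211))).resolve_right hA
  have hc12' : c 1 2 = -c 0 3 := by linarith
  rw [hc12'] at e1201 e1211
  have hc03 : c 0 3 = 0 := by
    refine (mul_eq_zero.1 (?_ : c 0 3 * I4 p = 0)).resolve_right hI
    rw [I4]
    linear_combination p.u1 2 * p.u1 3 * (e1211 - e1210 - e1201) + p.u1 2 ^ 2 * e1210 +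
      p.u1 3 ^ 2 * e1201
  rw [hc03] at e1210 e1201 hc12'
  have hb0 : b 0 = 0 := (mul_eq_zero.1 (by linarith : b 0 * p.u1 3 = 0)).resolve_right hB
  have hb1 : b 1 = 0 := (mul_eq_zero.1 (by linarith : b 1 * p.u1 2 = 0)).resolve_right hA
  simp only [hb0, hb1, zero_mul, add_zero, neg_eq_zero] at e1110 e1101 e0110 e0101
  simp only [hc02, hc13, hc03, hc12', hb0, hb1, e1110, e1101, zero_mul, zero_add, add_zero,
    neg_zero] at e0210 e0201 e0211
  obtain ⟨r, s, h1, h2, h3, h4, h5⟩ := exists_combination (A := p.u1 2)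
    (B := p.u1 3) (h11 := p.u2 2 2) (h12 := p.u2 2 3) (h22 := p.u2 3 3) (Fa := b 2)
    (Fb := b 3) (X := c 2 2) (Y := c 2 3) (Z := c 3 3)
    (by linear_combination e0210) (by linear_combination -e0201)
    (by linear_combination e0210 + e0201 - e0211) hB hd
  refine ⟨r, s, ContinuousLinearMap.ext fun v => ?_⟩
  rw [add_apply, smul_apply, smul_apply, hc, fderiv_I3, fderiv_I4, hc02, hc13, hc03, hc12', hb0,
    hb1, h1, h2, h3, h4, h5, he, hc01, e1310, e1301, e1110, e1101, e0110, e0101, smul_eq_mul,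
    smul_eq_mul]
  ring

/-- If the ridge jets cut out exactly the span of the differentials of `I` wherever the analytic
function `D` does not vanish, then `I` generates the differential invariants. -/
theorem onlyInvariants_h {c₁ c₂ c₃ c₄ : ℝ} {n : ℕ} {I : Fin n → J2 → ℝ}
    (hI : ∀ k, ContDiff ℝ ∞ (I k))
    (h0 : ∀ k α p, fderiv ℝ (I k) p (prolH c₁ c₂ c₃ c₄ α p) = 0) {D : J2 → ℝ}
    (hD : ContDiff ℝ ω D) {p₀ : J2} (hp₀ : D p₀ ≠ 0)
    (hind : ∀ p, D p ≠ 0 → LinearIndependent ℝ fun k => fderiv ℝ (I k) p)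
    (hspan : ∀ p, D p ≠ 0 → ∀ L : J2 →L[ℝ] ℝ,
      (∀ m k a b, L (prolH c₁ c₂ c₃ c₄ (monoJet m k a b) p) = 0) →
      L ∈ Submodule.span ℝ (Set.range fun k => fderiv ℝ (I k) p)) :
    OnlyInvariants (h c₁ c₂ c₃ c₄) I := by
  have hΩ : IsOpen {p | D p ≠ 0} := isOpen_ne_fun hD.continuous continuous_const
  refine ⟨fun k => ⟨hI k, isInvariant_h (hI k) (h0 k)⟩, {p | D p ≠ 0}, hΩ, dense_ne_zero hD hp₀,
    hind, fun U F hU hF hinv p hp => ?_⟩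
  refine exists_eq_comp hI (hind p hp.2) (hF.contDiffAt (hU.mem_nhds hp.1)) ?_
  filter_upwards [(hU.inter hΩ).mem_nhds hp] with q hq
  exact hspan q hq.2 _ (fderiv_prolH_monoJet hU hF hinv hq.1)

/-- The two-jet with vanishing base point and value, first derivatives `b` and second
derivatives `c`. -/
def verticalJet (b : Fin 4 → ℝ) (c : Sym2 (Fin 4) → ℝ) : J2 := (0, 0, b, c)

@[simp]
theorem verticalJet_base (b : Fin 4 → ℝ) (c : Sym2 (Fin 4) → ℝ) (i : Fin 4) :
    (verticalJet b c).base i = 0 := rfl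

@[simp]
theorem verticalJet_u1 (b : Fin 4 → ℝ) (c : Sym2 (Fin 4) → ℝ) (i : Fin 4) :
    (verticalJet b c).u1 i = b i := rfl

@[simp]
theorem verticalJet_u2 (b : Fin 4 → ℝ) (c : Sym2 (Fin 4) → ℝ) (i j : Fin 4) :
    (verticalJet b c).u2 i j = c s(i, j) := rfl

theorem fderiv_I1_ne_zero (p : J2) : fderiv ℝ I1 p ≠ 0 := fun h0 => by
  have := fderiv_I1 p (verticalJet 0 (Pi.single s(0, 3) 1))
  simp [h0] at this

theorem eq_zero_of_smul_fderiv_I3 {p : J2} {r : ℝ} (hp : p.u2 2 2 ≠ 0 ∨ p.u2 2 3 ≠ 0)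
    (hr : r • fderiv ℝ I3 p = 0) : r = 0 := by
  by_contra h
  have h0 := (smul_eq_zero.1 hr).resolve_left h
  have h1 := fderiv_I3 p (verticalJet 0 (Pi.single s(3, 3) 1))
  have h2 := fderiv_I3 p (verticalJet 0 (Pi.single s(2, 3) 1))
  simp [h0] at h1 h2
  tauto

theorem linearIndependent_I2_I3 {p : J2}
    (hd : (p.u1 3 - p.base 2) * p.u2 2 2 - (p.u1 2 + p.base 3) * p.u2 2 3 ≠ 0) :
    LinearIndependent ℝ ![fderiv ℝ I2 p, fderiv ℝ I3 p] := by
  refine LinearIndependent.pair_iff.2 fun r s hrs => ?_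
  have hr : r = 0 := by
    have := DFunLike.congr_fun hrs (verticalJet (Pi.single 3 1) 0)
    rw [add_apply, smul_apply, smul_apply, fderiv_I2, fderiv_I3] at this
    simpa [hd] using this
  refine ⟨hr, eq_zero_of_smul_fderiv_I3 ?_ (by simpa [hr] using hrs)⟩
  by_contra! h
  exact hd (by simp [h.1, h.2])

theorem linearIndependent_I3_I4 {p : J2}
    (hd : p.u1 3 * p.u2 2 2 - p.u1 2 * p.u2 2 3 ≠ 0) :
    LinearIndependent ℝ ![fderiv ℝ I3 p, fderiv ℝ I4 p] := by
  refine LinearIndependent.pair_iff.2 fun r s hrs => ?_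
  have hs : s = 0 := by
    have := DFunLike.congr_fun hrs (verticalJet (Pi.single 3 1) 0)
    rw [add_apply, smul_apply, smul_apply, fderiv_I3, fderiv_I4] at this
    simpa [hd] using this
  refine ⟨eq_zero_of_smul_fderiv_I3 ?_ (by simpa [hs] using hrs), hs⟩
  by_contra! h
  exact hd (by simp [h.1, h.2])

theorem fderiv_vecCons_two (f g : J2 → ℝ) (p : J2) :
    (fun k => fderiv ℝ (![f, g] k) p) = ![fderiv ℝ f p, fderiv ℝ g p] := by
  ext k : 1
  fin_cases k <;> rfl

theorem mem_span_range_pair {V : Type*} [AddCommGroup V] [Module ℝ V] {x y L : V}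
    (hL : ∃ r s : ℝ, L = r • x + s • y) : L ∈ Submodule.span ℝ (Set.range ![x, y]) := by
  obtain ⟨r, s, rfl⟩ := hL
  rw [Matrix.range_cons, Matrix.range_cons, Matrix.range_empty, Set.union_empty,
    Set.singleton_union]
  exact Submodule.mem_span_pair.2 ⟨r, s, rfl⟩

theorem onlyInvariants_g1 : OnlyInvariants g1 ![I1] := by
  rw [g1_eq_h]
  refine onlyInvariants_h (fun k => ?_) (fun k => ?_) (D := fun _ => 1) contDiff_const (p₀ := 0)
    one_ne_zero (fun p _ => ?_) fun p _ L hL => ?_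
  · rw [Subsingleton.elim k 0]
    exact contDiff_I1
  · rw [Subsingleton.elim k 0]
    exact fderiv_I1_prolH
  · exact linearIndependent_unique_iff.2 (fderiv_I1_ne_zero p)
  · obtain ⟨r, rfl⟩ := span_I1 hL
    exact Submodule.smul_mem _ _ (Submodule.subset_span ⟨0, rfl⟩)

theorem onlyInvariants_g2 : OnlyInvariants g2 ![I2, I3] := by
  refine onlyInvariants_h (Fin.forall_fin_two.2 ⟨contDiff_I2, contDiff_I3⟩)
    (Fin.forall_fin_two.2 ⟨fderiv_I2_prolH, fun α p => fderiv_I3_prolH α p _ _ _⟩)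
    (D := fun p => (p.u1 2 + p.base 3) * (p.u1 3 - p.base 2) *
      ((p.u1 3 - p.base 2) * p.u2 2 2 - (p.u1 2 + p.base 3) * p.u2 2 3))
    (by unfold J2.u2 J2.u1 J2.base; fun_prop) (p₀ := verticalJet 1 (Pi.single s(2, 2) 1))
    (by simp) (fun p hp => ?_) fun p hp L hL => ?_
  · rw [fderiv_vecCons_two]
    exact linearIndependent_I2_I3 (right_ne_zero_of_mul hp)
  · rw [fderiv_vecCons_two]
    have hAB := left_ne_zero_of_mul hp
    exact mem_span_range_pair (span_I2_I3 (left_ne_zero_of_mul hAB) (right_ne_zero_of_mul hAB)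
      (right_ne_zero_of_mul hp) hL)

theorem onlyInvariants_g3 {c₃ c₄ : ℝ} (hcc : (c₃, c₄) ≠ (0, 0)) :
    OnlyInvariants (g3 c₃ c₄) ![I3, I4] := by
  refine onlyInvariants_h (Fin.forall_fin_two.2 ⟨contDiff_I3, contDiff_I4⟩)
    (Fin.forall_fin_two.2 ⟨fun α p => fderiv_I3_prolH α p _ _ _,
      fun α p => fderiv_I4_prolH α p _ _⟩)
    (D := fun p => p.u1 2 * p.u1 3 * (p.u1 3 * p.u2 2 2 - p.u1 2 * p.u2 2 3) * I4 p)
    (by unfold I4 J2.u2 J2.u1; fun_prop) (p₀ := verticalJet 1 (Pi.single s(2, 2) 1))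
    (by simp [I4, cx, cy]) (fun p hp => ?_) fun p hp L hL => ?_
  · rw [fderiv_vecCons_two]
    exact linearIndependent_I3_I4 (right_ne_zero_of_mul (left_ne_zero_of_mul hp))
  · rw [fderiv_vecCons_two]
    have hd := left_ne_zero_of_mul hp
    have hAB := left_ne_zero_of_mul hd
    exact mem_span_range_pair (span_I3_I4 hcc (left_ne_zero_of_mul hAB)
      (right_ne_zero_of_mul hAB) (right_ne_zero_of_mul hd) (right_ne_zero_of_mul hp) hL)

end

end Plebanski

theorem mainTheorem1 :
    Plebanski.OnlyInvariants Plebanski.g1 ![Plebanski.I1] ∧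
    Plebanski.OnlyInvariants Plebanski.g2 ![Plebanski.I2, Plebanski.I3] ∧
    ∀ c₃ c₄ : ℝ, (c₃, c₄) ≠ (0, 0) →
      Plebanski.OnlyInvariants (Plebanski.g3 c₃ c₄) ![Plebanski.I3, Plebanski.I4] :=
  ⟨Plebanski.onlyInvariants_g1, Plebanski.onlyInvariants_g2,
    fun _ _ hcc => Plebanski.onlyInvariants_g3 hcc⟩
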